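/- Let $\mathbf G$ be a finite Abelian group (written additively), $q=|\mathbf G|$, and let $W$ be a discrete memoryless channel with input alphabet $\mathbf G$ and finite output alphabet $\mathcal Y$, with transition probabilities $W(y|x)$. Define the channels $$W^-(y_1,y_2|u_1)=\sum_{u_2\in\mathbf G}\tfrac1q W(y_1|u_1+u_2)W(y_2|u_2),\qquad W^+(y_1,y_2,u_1|u_2)=\tfrac1q W(y_1|u_1+u_2)W(y_2|u_2),$$ and, recursively, for $N=2^n$ and $1\le i\le N$, $W_1^{(1)}=W$, $W_{2N}^{(2i-1)}=(W_N^{(i)})^-$, $W_{2N}^{(2i)}=(W_N^{(i)})^+$. For a channel $V$ with input alphabet $\mathbf G$, $d\in\mathbf G$ and a subgroup $H\le\mathbf G$ put $$Z_d(V)=\frac1q\sum_{x\in\mathbf G}\sum_{y}\sqrt{V(y|x)V(y|x+d)},\qquad Z^H(V)=\sum_{d\in\mathbf G\setminus H}Z_d(V).$$ Let $B_1,B_2,\dots$ be independent fair $\{0,1\}$-valued random variables on a probability space, and let $J_n=1+\sum_{k=1}^n B_k2^{n-k}$, which is uniform on $\{1,\dots,2^n\}$. Put $Z_d^{n}=Z_d(W_{2^n}^{(J_n)})$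 and $(Z^H)^{(n)}=Z^H(W_{2^n}^{(J_n)})$. For a subgroup $S\le\mathbf G$ let $p_S$ be the probability that, as $n\to\infty$, $Z_d^{n}\to1$ for all $d\in S$ and $Z_d^{n}\to0$ for all $d\notin S$. Then for every subgroup $H\le\mathbf G$ the sequence $(Z^H)^{(n)}$ converges almost surely to a random variable $(Z^H)^{(\infty)}$, and for every real $\beta<\tfrac12$ the following limit exists and satisfies $$\lim_{n\to\infty}P\left((Z^H)^{(n)}<2^{-2^{\beta n}}\right)\ \ge\ P\left((Z^H)^{(\infty)}=0\right)=\sum_{S\le H}p_S .$$ -/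

import Mathlib

open MeasureTheory ProbabilityTheory Filter Topology

universe u

/-- A discrete memoryless channel with input alphabet `G` and some finite output alphabet `Out`;
`W x y` is the conditional probability `W(y|x)`. -/
structure DMChannel (G : Type u) where
  Out : Type u
  [fintypeOut : Fintype Out]
  W : G → Out → ℝ
  nonneg : ∀ x y, 0 ≤ W x y
  sum_eq_one : ∀ x, ∑ y, W x y = 1

attribute [instance] DMChannel.fintypeOut

namespace DMChannel

noncomputable section

variable {G : Type u} [AddCommGroup G] [Fintype G]

/-- `W⁻(y₁,y₂|u₁) = ∑_{u₂} (1/q) W(y₁|u₁+u₂) W(y₂|u₂)`. -/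
def minus (C : DMChannel G) : DMChannel G where
  Out := C.Out × C.Out
  W := fun u₁ y => ∑ u₂ : G, 1 / (Fintype.card G : ℝ) * C.W (u₁ + u₂) y.1 * C.W u₂ y.2
  nonneg := fun u₁ y => Finset.sum_nonneg fun u₂ _ =>
    mul_nonneg (mul_nonneg (by positivity) (C.nonneg _ _)) (C.nonneg _ _)
  sum_eq_one := fun u₁ => by
    have hq : (Fintype.card G : ℝ) ≠ 0 := Nat.cast_ne_zero.mpr Fintype.card_ne_zero
    rw [Finset.sum_comm]
    simp_rw [Fintype.sum_prod_type, ← Finset.mul_sum, C.sum_eq_one, mul_one, ← Finset.mul_sum,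
      C.sum_eq_one]
    simp [hq]

/-- `W⁺(y₁,y₂,u₁|u₂) = (1/q) W(y₁|u₁+u₂) W(y₂|u₂)`. -/
def plus (C : DMChannel G) : DMChannel G where
  Out := C.Out × C.Out × G
  W := fun u₂ y => 1 / (Fintype.card G : ℝ) * C.W (y.2.2 + u₂) y.1 * C.W u₂ y.2.1
  nonneg := fun u₂ y => mul_nonneg (mul_nonneg (by positivity) (C.nonneg _ _)) (C.nonneg _ _)
  sum_eq_one := fun u₂ => by
    have hq : (Fintype.card G : ℝ) ≠ 0 := Nat.cast_ne_zero.mpr Fintype.card_ne_zero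
    have h : ∀ u₁ : G, ∑ y₁, ∑ y₂,
        1 / (Fintype.card G : ℝ) * C.W (u₁ + u₂) y₁ * C.W u₂ y₂ = 1 / (Fintype.card G : ℝ) := by
      intro u₁
      simp_rw [← Finset.mul_sum, C.sum_eq_one, mul_one, ← Finset.mul_sum, C.sum_eq_one, mul_one]
    simp_rw [Fintype.sum_prod_type]
    rw [Finset.sum_congr rfl fun y₁ _ => Finset.sum_comm, Finset.sum_comm,
      Finset.sum_congr rfl fun u₁ _ => h u₁]
    simp [hq]

/-- The synthesized channel `W_N^{(i+1)}`, `N = 2^n`, with indices `i = 0, …, N - 1` counted from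
zero: `W_{2N}^{(2i-1)} = (W_N^{(i)})⁻` and `W_{2N}^{(2i)} = (W_N^{(i)})⁺` for `i = 1, …, N`. -/
def synth (C : DMChannel G) : ℕ → ℕ → DMChannel G
  | 0, _ => C
  | n + 1, i => if i % 2 = 0 then (C.synth n (i / 2)).minus else (C.synth n (i / 2)).plus

/-- `Z_d(W) = (1/q) ∑_x ∑_y √(W(y|x) W(y|x+d))`. -/
def Zd (C : DMChannel G) (d : G) : ℝ :=
  1 / (Fintype.card G : ℝ) * ∑ x : G, ∑ y, √(C.W x y * C.W (x + d) y)

open Classical in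
/-- `Z^H(W) = ∑_{d ∉ H} Z_d(W)`. -/
def ZH (C : DMChannel G) (H : AddSubgroup G) : ℝ :=
  ∑ d : G with d ∉ H, C.Zd d

end

end DMChannel

/-- The index, counted from zero, of the channel selected by the first `n` bits of `b`
(`false` selects `-`, `true` selects `+`). If the bits are independent and fair, then it is
uniform on `{0, …, 2^n - 1}`. -/
def polarIndex (b : ℕ → Bool) : ℕ → ℕ
  | 0 => 0
  | n + 1 => 2 * polarIndex b n + (b n).toNat

open Classical in
/-- `p_S`: the probability of the asymptotic case `S`, in which
`Z_d(W_N^{(J_n)})` tends to `1` for every `d ∈ S` and to `0` for every `d ∉ S`. -/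
noncomputable def polarCaseProb {G : Type u} [AddCommGroup G] [Fintype G] (C : DMChannel G)
    {Ω : Type*} [MeasurableSpace Ω] (μ : Measure Ω) (B : ℕ → Ω → Bool)
    (S : AddSubgroup G) : ℝ :=
  μ.real {ω | ∀ d : G, Tendsto
    (fun n => (C.synth n (polarIndex (fun k => B k ω) n)).Zd d) atTop
    (𝓝 (if d ∈ S then 1 else 0))}

/-! The bits `B` select a random path of channels, and everything is proved along almost every
single path.

Polarization: the equivocation (input entropy given the output, times `q`) is a bounded martingale,
because the minus and plus transforms conserve its sum (`equivocation_minus_add_plus`). Its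
increments are `±equivocationGap`; they are orthogonal in L², hence square summable, hence tend to
zero almost surely. Mixing over shifted inputs costs entropy, so the gap dominates `Z_d² (1 - Z_d)`
(`one_sub_Zd_mul_sq_le`). Since also `Z_d² ≤ Z_d'` at every step, each `Z_d` tends to 0 or to 1. As
`1 - Z_d` is a mean squared Hellinger distance, the shifts with limit 1 form a subgroup `S`. Thus
`Z^H` tends to the number of elements of `S` outside `H`, which vanishes exactly when `S ≤ H`.

Rate: a plus step at least squares `Z^H`, a minus step multiplies it by at most `q²`, and by the
strong law half of the steps are plus steps. So where `Z^H → 0`, it is eventually below the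
threshold (`eventually_lt_two_rpow_neg`).

Existence of the limit: where `Z^H` does not vanish asymptotically, it must eventually stay above
the threshold, which itself tends to 1 when `β < 0`. Some `d ∉ H` has `Z_d → 1`. If `d ≠ -d`, then
`d` and `-d` together push `Z^H` above 1. If `2d = 0`, then `1 - Z_d` is squared up to a constant by
minus steps and so vanishes doubly exponentially (`one_sub_Zd_minus_le`). Hence the indicators
converge almost surely, and the limit is exactly `P(Zinf = 0)`. -/

set_option linter.unusedSectionVars false

/-! ### Bhattacharyya parameters under one polarization step -/

namespace DMChannel

variable {G : Type u} [AddCommGroup G] [Fintype G]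

lemma card_pos_real : (0 : ℝ) < Fintype.card G := Nat.cast_pos.mpr Fintype.card_pos

lemma sum_add_right_eq (f : G → ℝ) (d : G) : ∑ x, f (x + d) = ∑ x, f x :=
  Fintype.sum_equiv (Equiv.addRight d) _ _ fun _ => rfl

/-- The Bhattacharyya coefficient of the output laws of two inputs. -/
noncomputable def bhatt (C : DMChannel G) (x x' : G) : ℝ := ∑ y, √(C.W x y * C.W x' y)

lemma Zd_eq (C : DMChannel G) (d : G) :
    C.Zd d = 1 / (Fintype.card G : ℝ) * ∑ x : G, C.bhatt x (x + d) := rfl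

lemma bhatt_nonneg (C : DMChannel G) (x x' : G) : 0 ≤ C.bhatt x x' :=
  Finset.sum_nonneg fun _ _ => Real.sqrt_nonneg _

lemma Zd_nonneg (C : DMChannel G) (d : G) : 0 ≤ C.Zd d :=
  mul_nonneg (by positivity) (Finset.sum_nonneg fun _ _ => C.bhatt_nonneg _ _)

lemma card_mul_Zd (C : DMChannel G) (d : G) :
    (Fintype.card G : ℝ) * C.Zd d = ∑ x : G, C.bhatt x (x + d) := by
  have := (card_pos_real (G := G)).ne'
  rw [Zd_eq]; field_simp

lemma hellinger_eq (C : DMChannel G) (x x' : G) :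
    ∑ y, (√(C.W x y) - √(C.W x' y)) ^ 2 = 2 * (1 - C.bhatt x x') := by
  have h : ∀ y, (√(C.W x y) - √(C.W x' y)) ^ 2
      = C.W x y + C.W x' y - 2 * √(C.W x y * C.W x' y) := by
    intro y
    rw [Real.sqrt_mul (C.nonneg _ _), sub_sq, Real.sq_sqrt (C.nonneg _ _),
      Real.sq_sqrt (C.nonneg _ _)]
    ring
  simp_rw [h, Finset.sum_sub_distrib, Finset.sum_add_distrib, C.sum_eq_one, ← Finset.mul_sum]
  simp only [bhatt]; ring

lemma sum_hellinger_eq (C : DMChannel G) (d : G) :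
    ∑ x, ∑ y, (√(C.W x y) - √(C.W (x + d) y)) ^ 2
      = 2 * (Fintype.card G : ℝ) * (1 - C.Zd d) := by
  simp_rw [hellinger_eq, ← Finset.mul_sum, Finset.sum_sub_distrib, ← card_mul_Zd]
  simp; ring

lemma Zd_le_one (C : DMChannel G) (d : G) : C.Zd d ≤ 1 := by
  have h := C.sum_hellinger_eq d
  have h0 : 0 ≤ ∑ x, ∑ y, (√(C.W x y) - √(C.W (x + d) y)) ^ 2 :=
    Finset.sum_nonneg fun _ _ => Finset.sum_nonneg fun _ _ => sq_nonneg _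
  have := card_pos_real (G := G)
  rw [h] at h0
  by_contra hlt
  nlinarith

lemma Zd_zero (C : DMChannel G) : C.Zd 0 = 1 := by
  have h := C.sum_hellinger_eq 0
  have := card_pos_real (G := G)
  simp at h
  linarith

lemma Zd_neg (C : DMChannel G) (d : G) : C.Zd (-d) = C.Zd d := by
  have := sum_add_right_eq (fun x => C.bhatt x (x + -d)) d
  rw [Zd_eq, Zd_eq, ← this]
  simp [bhatt, mul_comm]

/-- `1 - Z_d` averages half the squared Hellinger distance between the laws at `x` and `x + d`. Pass
through `x + d` on the way to `x + d + e` and use `(a + b)² ≤ 2a² + 2b²`. This closes the set of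
shifts with `Z_d → 1` under addition. -/
lemma one_sub_Zd_add_le (C : DMChannel G) (d e : G) :
    1 - C.Zd (d + e) ≤ 2 * (1 - C.Zd d) + 2 * (1 - C.Zd e) := by
  have hd := C.sum_hellinger_eq d
  have hde := C.sum_hellinger_eq (d + e)
  have he : ∑ x, ∑ y, (√(C.W (x + d) y) - √(C.W (x + (d + e)) y)) ^ 2
      = 2 * (Fintype.card G : ℝ) * (1 - C.Zd e) := by
    rw [← C.sum_hellinger_eq e,
      ← sum_add_right_eq (fun x => ∑ y, (√(C.W x y) - √(C.W (x + e) y)) ^ 2) d]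
    simp [add_assoc]
  have key : ∑ x, ∑ y, (√(C.W x y) - √(C.W (x + (d + e)) y)) ^ 2
      ≤ ∑ x, ∑ y, (2 * (√(C.W x y) - √(C.W (x + d) y)) ^ 2
        + 2 * (√(C.W (x + d) y) - √(C.W (x + (d + e)) y)) ^ 2) := by
    refine Finset.sum_le_sum fun x _ => Finset.sum_le_sum fun y _ => ?_
    nlinarith [sq_nonneg (√(C.W x y) - 2 * √(C.W (x + d) y) + √(C.W (x + (d + e)) y))]
  simp_rw [Finset.sum_add_distrib, ← Finset.mul_sum] at key
  rw [hde, hd, he] at key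
  have := card_pos_real (G := G)
  by_contra hlt
  nlinarith

lemma sum_sum_shift (f g : G → ℝ) :
    ∑ u : G, ∑ v : G, f (u + v) * g v = (∑ u, f u) * ∑ v, g v := by
  rw [Finset.sum_comm, Finset.mul_sum]
  refine Finset.sum_congr rfl fun v _ => ?_
  rw [← Finset.sum_mul, sum_add_right_eq f v]

/-- Once `u₁` is revealed, a shift of `u₂` shifts both channel inputs, so the square root factors.
Averaging over `u₁` makes the two inputs independent. -/
lemma Zd_plus (C : DMChannel G) (d : G) : C.plus.Zd d = C.Zd d ^ 2 := by
  have hq := card_pos_real (G := G)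
  have h : ∀ u₂ : G, C.plus.bhatt u₂ (u₂ + d) = 1 / (Fintype.card G : ℝ) *
      ∑ u₁ : G, C.bhatt (u₁ + u₂) (u₁ + u₂ + d) * C.bhatt u₂ (u₂ + d) := by
    intro u₂
    have e : ∀ (y₁ y₂ : C.Out) (u₁ : G),
        √(C.plus.W u₂ (y₁, y₂, u₁) * C.plus.W (u₂ + d) (y₁, y₂, u₁))
        = 1 / (Fintype.card G : ℝ) * (√(C.W (u₁ + u₂) y₁ * C.W (u₁ + u₂ + d) y₁)
          * √(C.W u₂ y₂ * C.W (u₂ + d) y₂)) := by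
      intro y₁ y₂ u₁
      rw [← Real.sqrt_mul (mul_nonneg (C.nonneg _ _) (C.nonneg _ _))]
      have : (1 / (Fintype.card G : ℝ)) = √((1 / (Fintype.card G : ℝ)) ^ 2) :=
        (Real.sqrt_sq (by positivity)).symm
      rw [this, ← Real.sqrt_mul (by positivity)]
      simp only [plus]
      congr 1
      rw [add_assoc u₁ u₂ d]
      ring
    have : C.plus.bhatt u₂ (u₂ + d) = ∑ y₁, ∑ y₂, ∑ u₁,
        √(C.plus.W u₂ (y₁, y₂, u₁) * C.plus.W (u₂ + d) (y₁, y₂, u₁)) := by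
      simp only [bhatt]
      rw [show (∑ y : C.plus.Out, √(C.plus.W u₂ y * C.plus.W (u₂ + d) y))
        = ∑ y : C.Out × C.Out × G, √(C.plus.W u₂ y * C.plus.W (u₂ + d) y) from rfl]
      simp_rw [Fintype.sum_prod_type]
    rw [this]
    simp_rw [e, ← Finset.mul_sum, bhatt, Finset.sum_mul_sum]
    congr 1
    rw [Finset.sum_congr rfl fun y₁ _ => Finset.sum_comm, Finset.sum_comm]
  rw [Zd_eq]
  simp_rw [h, ← Finset.mul_sum]
  rw [Finset.sum_comm, sum_sum_shift (fun x => C.bhatt x (x + d)) (fun x => C.bhatt x (x + d)),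
    ← card_mul_Zd]
  field_simp

lemma bhatt_minus (C : DMChannel G) (x x' : G) :
    C.minus.bhatt x x' = ∑ y₁, ∑ y₂, √((∑ u : G, 1 / (Fintype.card G : ℝ) * C.W (x + u) y₁
      * C.W u y₂) * ∑ u : G, 1 / (Fintype.card G : ℝ) * C.W (x' + u) y₁ * C.W u y₂) := by
  simp only [bhatt]
  rw [show (∑ y : C.minus.Out, √(C.minus.W x y * C.minus.W x' y))
    = ∑ y : C.Out × C.Out, √(C.minus.W x y * C.minus.W x' y) from rfl]
  rw [Fintype.sum_prod_type]
  rfl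

lemma sqrt_sum_le_sum_sqrt {ι : Type*} (s : Finset ι) (f : ι → ℝ) (hf : ∀ i, 0 ≤ f i) :
    √(∑ i ∈ s, f i) ≤ ∑ i ∈ s, √(f i) := by
  classical
  induction s using Finset.induction_on with
  | empty => simp
  | insert a s ha ih =>
    rw [Finset.sum_insert ha, Finset.sum_insert ha]
    refine (Real.sqrt_le_iff.mpr ⟨by positivity, ?_⟩ :
      √(f a + ∑ i ∈ s, f i) ≤ √(f a) + √(∑ i ∈ s, f i)).trans (by linarith)
    have h₁ := Real.sq_sqrt (hf a)
    have h₂ := Real.sq_sqrt (Finset.sum_nonneg fun i (_ : i ∈ s) => hf i)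
    nlinarith [mul_nonneg (Real.sqrt_nonneg (f a)) (Real.sqrt_nonneg (∑ i ∈ s, f i))]

lemma sum_sqrt_mul_le {ι : Type*} (s : Finset ι) (f g : ι → ℝ) (hf : ∀ i, 0 ≤ f i)
    (hg : ∀ i, 0 ≤ g i) : ∑ i ∈ s, √(f i * g i) ≤ √((∑ i ∈ s, f i) * ∑ i ∈ s, g i) := by
  rw [Real.sqrt_mul (Finset.sum_nonneg fun i _ => hf i)]
  simp_rw [Real.sqrt_mul (hf _)]
  exact Real.sum_sqrt_mul_sqrt_le s hf hg

/-- Subadditivity of the square root separates the two mixtures. A pair of mixed inputs `u`, `v` is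
then indexed by `u` and `e = v - u`. -/
lemma Zd_minus_le (C : DMChannel G) (d : G) :
    C.minus.Zd d ≤ ∑ e : G, C.Zd e * C.Zd (d + e) := by
  have hq := card_pos_real (G := G)
  set q : ℝ := (Fintype.card G : ℝ) with hqdef
  have h : ∀ u₁ : G, C.minus.bhatt u₁ (u₁ + d) ≤
      ∑ u : G, ∑ e : G, 1 / q * (C.bhatt (u₁ + u) (u₁ + u + (d + e)) * C.bhatt u (u + e)) := by
    intro u₁
    rw [bhatt_minus]
    have e : ∀ y₁ y₂, √((∑ u : G, 1 / q * C.W (u₁ + u) y₁ * C.W u y₂)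
        * ∑ u : G, 1 / q * C.W (u₁ + d + u) y₁ * C.W u y₂)
        ≤ ∑ u : G, ∑ e : G, 1 / q * (√(C.W (u₁ + u) y₁ * C.W (u₁ + u + (d + e)) y₁)
          * √(C.W u y₂ * C.W (u + e) y₂)) := by
      intro y₁ y₂
      rw [Finset.sum_mul_sum]
      have hn : ∀ u v : G, 0 ≤ 1 / q * C.W (u₁ + u) y₁ * C.W u y₂
          * (1 / q * C.W (u₁ + d + v) y₁ * C.W v y₂) := fun u v => by
        have := C.nonneg (u₁ + u) y₁
        have := C.nonneg u y₂
        have := C.nonneg (u₁ + d + v) y₁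
        have := C.nonneg v y₂
        positivity
      refine (sqrt_sum_le_sum_sqrt _ _ fun u => Finset.sum_nonneg fun v _ => hn u v).trans ?_
      refine Finset.sum_le_sum fun u _ => ?_
      refine (sqrt_sum_le_sum_sqrt _ _ fun v => hn u v).trans (le_of_eq ?_)
      rw [← sum_add_right_eq _ u]
      refine Finset.sum_congr rfl fun e _ => ?_
      rw [← Real.sqrt_mul (mul_nonneg (C.nonneg _ _) (C.nonneg _ _))]
      have : (1 / q) = √((1 / q) ^ 2) := (Real.sqrt_sq (by positivity)).symm
      conv_rhs => rw [this, ← Real.sqrt_mul (by positivity)]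
      congr 1
      rw [show u₁ + d + (e + u) = u₁ + u + (d + e) by abel, add_comm e u]
      ring
    refine (Finset.sum_le_sum fun y₁ _ => Finset.sum_le_sum fun y₂ _ => e y₁ y₂).trans
      (le_of_eq ?_)
    simp_rw [bhatt, Finset.sum_mul_sum, Finset.mul_sum]
    rw [Finset.sum_congr rfl fun y₁ _ => Finset.sum_comm, Finset.sum_comm]
    refine Finset.sum_congr rfl fun u _ => ?_
    rw [Finset.sum_congr rfl fun y₁ _ => Finset.sum_comm, Finset.sum_comm]
  have h2 : ∑ u₁, C.minus.bhatt u₁ (u₁ + d) ≤ q * ∑ e : G, C.Zd e * C.Zd (d + e) := by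
    refine (Finset.sum_le_sum fun u₁ _ => h u₁).trans (le_of_eq ?_)
    rw [Finset.sum_congr rfl fun u₁ _ => Finset.sum_comm, Finset.sum_comm, Finset.mul_sum]
    refine Finset.sum_congr rfl fun e _ => ?_
    simp_rw [← Finset.mul_sum]
    rw [sum_sum_shift (fun x => C.bhatt x (x + (d + e))) (fun x => C.bhatt x (x + e)),
      ← card_mul_Zd, ← card_mul_Zd, ← hqdef]
    field_simp
  rw [Zd_eq, div_mul_eq_mul_div, one_mul, div_le_iff₀ hq]
  linarith

/-- Joint concavity of the Bhattacharyya coefficient: Cauchy–Schwarz with the same hidden input `u`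
in both mixtures. -/
lemma Zd_le_Zd_minus (C : DMChannel G) (d : G) : C.Zd d ≤ C.minus.Zd d := by
  have hq := card_pos_real (G := G)
  set q : ℝ := (Fintype.card G : ℝ) with hqdef
  have h : ∀ u₁ : G, ∑ u : G, 1 / q * C.bhatt (u₁ + u) (u₁ + u + d)
      ≤ C.minus.bhatt u₁ (u₁ + d) := by
    intro u₁
    rw [bhatt_minus]
    have e : ∀ y₁ y₂, ∑ u : G, 1 / q * (√(C.W (u₁ + u) y₁ * C.W (u₁ + u + d) y₁) * C.W u y₂)
        ≤ √((∑ u : G, 1 / q * C.W (u₁ + u) y₁ * C.W u y₂)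
        * ∑ u : G, 1 / q * C.W (u₁ + d + u) y₁ * C.W u y₂) := by
      intro y₁ y₂
      refine le_trans (le_of_eq ?_) (sum_sqrt_mul_le _ _ _
        (fun u => mul_nonneg (mul_nonneg (by positivity) (C.nonneg _ _)) (C.nonneg _ _))
        (fun u => mul_nonneg (mul_nonneg (by positivity) (C.nonneg _ _)) (C.nonneg _ _)))
      refine Finset.sum_congr rfl fun u _ => ?_
      rw [show u₁ + d + u = u₁ + u + d by abel]
      rw [show 1 / q * C.W (u₁ + u) y₁ * C.W u y₂ * (1 / q * C.W (u₁ + u + d) y₁ * C.W u y₂)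
        = (C.W (u₁ + u) y₁ * C.W (u₁ + u + d) y₁) * (1 / q * C.W u y₂) ^ 2 by ring,
        Real.sqrt_mul (mul_nonneg (C.nonneg _ _) (C.nonneg _ _)),
        Real.sqrt_sq (mul_nonneg (by positivity) (C.nonneg _ _))]
      ring
    refine le_trans (le_of_eq ?_)
      (Finset.sum_le_sum fun y₁ _ => Finset.sum_le_sum fun y₂ _ => e y₁ y₂)
    rw [Finset.sum_congr rfl fun y₁ _ => Finset.sum_comm, Finset.sum_comm]
    refine Finset.sum_congr rfl fun u _ => ?_
    simp_rw [← Finset.mul_sum, C.sum_eq_one, mul_one, bhatt]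
  have h2 := Finset.sum_le_sum fun u₁ (_ : u₁ ∈ (Finset.univ : Finset G)) => h u₁
  have h3 := sum_sum_shift (fun x => C.bhatt x (x + d)) (fun _ : G => (1 : ℝ))
  simp only [mul_one] at h3
  simp_rw [← Finset.mul_sum, h3, ← card_mul_Zd] at h2
  simp only [Finset.sum_const, Finset.card_univ, nsmul_eq_mul, mul_one] at h2
  rw [← hqdef] at h2
  have : 1 / q * (q * C.Zd d * q) = q * C.Zd d := by field_simp
  rw [this] at h2
  exact le_of_mul_le_mul_left h2 hq

/-- Pointwise core of the order-two case. With arithmetic means `P`, `R`, geometric means `g`, `k`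
and `m = (P - g)(R - k)`, half the root on the right squares to `P²R² - m (P + g)(R + k)`. This is
at least `PR (PR - 4m)`, hence at least `(PR - 4m)²` when `PR - 4m ≥ 0`. -/
lemma binary_minus_ineq {p₀ p₁ r₀ r₁ : ℝ} (hp₀ : 0 ≤ p₀) (hp₁ : 0 ≤ p₁) (hr₀ : 0 ≤ r₀)
    (hr₁ : 0 ≤ r₁) :
    ((p₀ + p₁) / 2) * ((r₀ + r₁) / 2)
      - 4 * (((p₀ + p₁) / 2 - √(p₀ * p₁)) * ((r₀ + r₁) / 2 - √(r₀ * r₁)))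
      ≤ 1 / 2 * √((p₀ * r₀ + p₁ * r₁) * (p₁ * r₀ + p₀ * r₁)) := by
  have hg2 := Real.sq_sqrt (mul_nonneg hp₀ hp₁)
  have hk2 := Real.sq_sqrt (mul_nonneg hr₀ hr₁)
  have hg0 := Real.sqrt_nonneg (p₀ * p₁)
  have hk0 := Real.sqrt_nonneg (r₀ * r₁)
  have hgP : √(p₀ * p₁) ≤ (p₀ + p₁) / 2 :=
    Real.sqrt_le_iff.mpr ⟨by positivity, by nlinarith [sq_nonneg (p₀ - p₁)]⟩
  have hkR : √(r₀ * r₁) ≤ (r₀ + r₁) / 2 :=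
    Real.sqrt_le_iff.mpr ⟨by positivity, by nlinarith [sq_nonneg (r₀ - r₁)]⟩
  generalize √(p₀ * p₁) = g at *
  generalize √(r₀ * r₁) = k at *
  obtain ⟨P, hP⟩ : ∃ P, P = (p₀ + p₁) / 2 := ⟨_, rfl⟩
  obtain ⟨R, hR⟩ : ∃ R, R = (r₀ + r₁) / 2 := ⟨_, rfl⟩
  have hX : (p₀ * r₀ + p₁ * r₁) * (p₁ * r₀ + p₀ * r₁)
      = 2 ^ 2 * (g ^ 2 * R ^ 2 + k ^ 2 * P ^ 2 - g ^ 2 * k ^ 2) := by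
    rw [hg2, hk2, hP, hR]; ring
  rw [hX, Real.sqrt_mul (by norm_num), Real.sqrt_sq (by norm_num), one_div,
    inv_mul_cancel_left₀ two_ne_zero, ← hP, ← hR]
  rw [← hP] at hgP
  rw [← hR] at hkR
  rcases le_total (P * R - 4 * ((P - g) * (R - k))) 0 with hY | hY
  · exact hY.trans (Real.sqrt_nonneg _)
  refine Real.le_sqrt_of_sq_le ?_
  have hPR : 0 ≤ P * R := mul_nonneg (hg0.trans hgP) (hk0.trans hkR)
  have hm : 0 ≤ (P - g) * (R - k) := mul_nonneg (by linarith) (by linarith)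
  have h1 : (P + g) * (R + k) ≤ 4 * (P * R) := by nlinarith
  have h2 : (P - g) * (R - k) * ((P + g) * (R + k)) ≤ (P - g) * (R - k) * (4 * (P * R)) :=
    mul_le_mul_of_nonneg_left h1 hm
  have h3 : (P * R - 4 * ((P - g) * (R - k))) ^ 2
      ≤ P * R * (P * R - 4 * ((P - g) * (R - k))) := by
    rw [sq]
    exact mul_le_mul_of_nonneg_right (by linarith) hY
  linarith

/-- As `2d = 0`, the hidden inputs split into pairs `{u, u + d}`, and a shift by `d` swaps the
members of each pair, as for a binary channel. Cauchy–Schwarz over the pairs reduces the claim to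
`binary_minus_ineq`. -/
lemma one_sub_Zd_minus_le (C : DMChannel G) {d : G} (hd : d + d = 0) :
    1 - C.minus.Zd d ≤ 4 * (1 - C.Zd d) ^ 2 := by
  have hq := card_pos_real (G := G)
  obtain ⟨q, hqdef⟩ : ∃ q : ℝ, q = (Fintype.card G : ℝ) := ⟨_, rfl⟩
  have h : ∀ u₁ : G, ∑ u : G, 1 / q * (1 - 4 * ((1 - C.bhatt (u₁ + u) (u₁ + u + d))
      * (1 - C.bhatt u (u + d)))) ≤ C.minus.bhatt u₁ (u₁ + d) := by
    intro u₁
    rw [bhatt_minus, ← hqdef]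
    have e : ∀ y₁ y₂, ∑ u : G, 1 / q *
        (((C.W (u₁ + u) y₁ + C.W (u₁ + u + d) y₁) / 2) * ((C.W u y₂ + C.W (u + d) y₂) / 2)
        - 4 * (((C.W (u₁ + u) y₁ + C.W (u₁ + u + d) y₁) / 2
            - √(C.W (u₁ + u) y₁ * C.W (u₁ + u + d) y₁))
          * ((C.W u y₂ + C.W (u + d) y₂) / 2 - √(C.W u y₂ * C.W (u + d) y₂))))
        ≤ √((∑ u : G, 1 / q * C.W (u₁ + u) y₁ * C.W u y₂)
        * ∑ u : G, 1 / q * C.W (u₁ + d + u) y₁ * C.W u y₂) := by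
      intro y₁ y₂
      -- Each pair is met twice, from `u` and from `u + d`, whence the factor `1 / 2`.
      have hpair : ∀ f : G → ℝ, ∑ u, f u = 1 / 2 * ∑ u, (f u + f (u + d)) := by
        intro f
        rw [Finset.sum_add_distrib, sum_add_right_eq]
        ring
      have hq' : 0 ≤ 1 / q := by rw [hqdef]; positivity
      have n1 : ∀ u₁ u : G, 0 ≤ 1 / q * C.W (u₁ + u) y₁ * C.W u y₂ := fun u₁ u =>
        mul_nonneg (mul_nonneg hq' (C.nonneg _ _)) (C.nonneg _ _)
      rw [hpair (fun u => 1 / q * C.W (u₁ + u) y₁ * C.W u y₂),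
        hpair (fun u => 1 / q * C.W (u₁ + d + u) y₁ * C.W u y₂),
        show ∀ a b : ℝ, 1 / 2 * a * (1 / 2 * b) = (1 / 2) ^ 2 * (a * b) by intros; ring,
        Real.sqrt_mul (by positivity), Real.sqrt_sq (by positivity)]
      refine le_trans ?_ (mul_le_mul_of_nonneg_left (sum_sqrt_mul_le _ _ _
        (fun u => add_nonneg (n1 _ _) (n1 _ _)) (fun u => add_nonneg (n1 _ _) (n1 _ _)))
        (by positivity))
      rw [Finset.mul_sum]
      refine Finset.sum_le_sum fun u _ => ?_
      refine (mul_le_mul_of_nonneg_left (binary_minus_ineq (C.nonneg (u₁ + u) y₁)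
        (C.nonneg (u₁ + u + d) y₁) (C.nonneg u y₂) (C.nonneg (u + d) y₂)) hq').trans
        (le_of_eq ?_)
      have e1 : u₁ + d + (u + d) = u₁ + u := by
        rw [show u₁ + d + (u + d) = u₁ + u + (d + d) by abel, hd, add_zero]
      rw [e1, show u₁ + d + u = u₁ + u + d by abel, ← add_assoc u₁ u d]
      generalize C.W (u₁ + u) y₁ = p₀
      generalize C.W (u₁ + u + d) y₁ = p₁
      generalize C.W u y₂ = r₀
      generalize C.W (u + d) y₂ = r₁
      rw [show (1 / q * p₀ * r₀ + 1 / q * p₁ * r₁) * (1 / q * p₁ * r₀ + 1 / q * p₀ * r₁)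
        = (1 / q) ^ 2 * ((p₀ * r₀ + p₁ * r₁) * (p₁ * r₀ + p₀ * r₁)) by ring,
        Real.sqrt_mul (sq_nonneg (1 / q)), Real.sqrt_sq hq']
      ring
    refine le_trans (le_of_eq ?_)
      (Finset.sum_le_sum fun y₁ _ => Finset.sum_le_sum fun y₂ _ => e y₁ y₂)
    rw [Finset.sum_congr rfl fun y₁ _ => Finset.sum_comm, Finset.sum_comm]
    refine Finset.sum_congr rfl fun u _ => ?_
    have hs : ∀ x x' : G, ∑ y, (C.W x y + C.W x' y) / 2 = 1 := fun x x' => by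
      rw [← Finset.sum_div, Finset.sum_add_distrib, C.sum_eq_one, C.sum_eq_one]; norm_num
    simp_rw [← Finset.mul_sum, Finset.sum_sub_distrib, ← Finset.mul_sum,
      Finset.sum_sub_distrib, hs]
    rw [← Finset.sum_mul, ← Finset.sum_mul, Finset.sum_sub_distrib, hs]
    simp only [bhatt, one_mul]
  have h2 := Finset.sum_le_sum fun u₁ (_ : u₁ ∈ (Finset.univ : Finset G)) => h u₁
  have h3 := sum_sum_shift (fun x => 1 - C.bhatt x (x + d)) (fun x => 1 - C.bhatt x (x + d))
  simp_rw [← Finset.mul_sum, Finset.sum_sub_distrib, ← Finset.mul_sum, h3,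
    Finset.sum_sub_distrib, ← card_mul_Zd] at h2
  simp only [Finset.sum_const, Finset.card_univ, nsmul_eq_mul, mul_one] at h2
  rw [← hqdef] at h2 hq
  have : 1 / q * (q * q - 4 * ((q - q * C.Zd d) * (q - q * C.Zd d)))
      = q * (1 - 4 * (1 - C.Zd d) ^ 2) := by field_simp
  rw [this] at h2
  have := le_of_mul_le_mul_left h2 hq
  linarith

lemma one_sub_Zd_plus_le (C : DMChannel G) (d : G) :
    1 - C.plus.Zd d ≤ 2 * (1 - C.Zd d) := by
  rw [Zd_plus]
  nlinarith [sq_nonneg (1 - C.Zd d)]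

lemma ZH_nonneg (C : DMChannel G) (H : AddSubgroup G) : 0 ≤ C.ZH H :=
  Finset.sum_nonneg fun _ _ => C.Zd_nonneg _

lemma Zd_le_ZH (C : DMChannel G) {H : AddSubgroup G} {d : G} (hd : d ∉ H) :
    C.Zd d ≤ C.ZH H := by
  classical
  exact Finset.single_le_sum (f := fun d => C.Zd d) (fun _ _ => C.Zd_nonneg _)
    (Finset.mem_filter.mpr ⟨Finset.mem_univ _, hd⟩)

lemma ZH_plus_le (C : DMChannel G) (H : AddSubgroup G) : C.plus.ZH H ≤ C.ZH H ^ 2 := by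
  classical
  simp only [ZH, Zd_plus]
  exact Finset.sum_sq_le_sq_sum_of_nonneg fun _ _ => C.Zd_nonneg _

/-- For `d ∉ H`, the shifts `e` and `d + e` cannot both lie in `H`, so every product in
`Zd_minus_le` has a factor bounded by `Z^H`. -/
lemma ZH_minus_le (C : DMChannel G) (H : AddSubgroup G) :
    C.minus.ZH H ≤ (Fintype.card G : ℝ) ^ 2 * C.ZH H := by
  classical
  have h : ∀ d : G, d ∉ H → C.minus.Zd d ≤ (Fintype.card G : ℝ) * C.ZH H := by
    intro d hd
    refine (C.Zd_minus_le d).trans ?_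
    rw [← nsmul_eq_mul, ← Finset.card_univ]
    refine Finset.sum_le_card_nsmul _ _ _ fun e _ => ?_
    by_cases he : e ∈ H
    · have : d + e ∉ H := fun h => hd ((H.add_mem_cancel_right he).mp h)
      exact (mul_le_of_le_one_left (C.Zd_nonneg _) (C.Zd_le_one _)).trans (C.Zd_le_ZH this)
    · exact (mul_le_of_le_one_right (C.Zd_nonneg _) (C.Zd_le_one _)).trans (C.Zd_le_ZH he)
  have h0 := C.ZH_nonneg H
  refine (Finset.sum_le_card_nsmul _ _ _ fun d hd => h d (Finset.mem_filter.mp hd).2).trans ?_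
  rw [nsmul_eq_mul, sq, mul_assoc]
  refine mul_le_mul_of_nonneg_right ?_ (by positivity)
  exact_mod_cast Finset.card_le_univ _

/-! ### Equivocation and its increase under the minus transform -/

open Real (negMulLog)

/-- Pointwise form of "relative entropy dominates squared Hellinger distance", from `log r ≥ 1 - 1 /
r` at `r = √a / √m`. -/
lemma sq_sub_sqrt_le_mul_log {a m : ℝ} (ha : 0 ≤ a) (hm : 0 < m) :
    (√a - √m) ^ 2 ≤ a * Real.log a - a * Real.log m - a + m := by
  rcases ha.eq_or_lt with rfl | ha
  · simp [Real.sq_sqrt hm.le]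
  have hsm := Real.sqrt_pos.mpr hm
  have hsa := Real.sqrt_pos.mpr ha
  have h := Real.one_sub_inv_le_log_of_pos (div_pos hsa hsm)
  rw [Real.log_div hsa.ne' hsm.ne', Real.log_sqrt ha.le, Real.log_sqrt hm.le, inv_div] at h
  have h2 := mul_le_mul_of_nonneg_left h ha.le
  have h3 : a * (1 - √m / √a) = a - √a * √m := by
    rw [mul_sub, mul_one, mul_div_assoc', sub_right_inj, div_eq_iff hsa.ne']
    linear_combination (-√m) * Real.mul_self_sqrt ha.le
  rw [sub_sq, Real.sq_sqrt ha.le, Real.sq_sqrt hm.le]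
  linarith

/-- A lower bound on the Jensen gap of `negMulLog` with unnormalized weights. -/
lemma jensen_gap_negMulLog {ι : Type*} [Fintype ι] (w a : ι → ℝ) (hw : ∀ i, 0 ≤ w i)
    (ha : ∀ i, 0 ≤ a i) :
    ∑ i, w i * negMulLog (a i) - (∑ i, w i * a i) * Real.log (∑ i, w i)
      + 1 / 2 * ∑ i, ∑ j, w i * w j / (∑ k, w k) * (√(a i) - √(a j)) ^ 2
      ≤ negMulLog (∑ i, w i * a i) := by
  obtain ⟨s, hs⟩ : ∃ s, s = ∑ k, w k := ⟨_, rfl⟩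
  obtain ⟨t, ht⟩ : ∃ t, t = ∑ i, w i * a i := ⟨_, rfl⟩
  rw [← hs, ← ht]
  have ht0 : 0 ≤ t := ht ▸ Finset.sum_nonneg fun i _ => mul_nonneg (hw i) (ha i)
  have hs0 : 0 ≤ s := hs ▸ Finset.sum_nonneg fun i _ => hw i
  rcases ht0.eq_or_lt with ht' | ht'
  · have h0 : ∀ i, w i * a i = 0 := fun i =>
      (Finset.sum_eq_zero_iff_of_nonneg fun i _ => mul_nonneg (hw i) (ha i)).mp
        (ht.symm.trans ht'.symm) i (Finset.mem_univ i)
    have h1 : ∀ i, w i * negMulLog (a i) = 0 := fun i => by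
      rcases mul_eq_zero.mp (h0 i) with h | h <;> simp [h]
    have h2 : ∀ i j, w i * w j / s * (√(a i) - √(a j)) ^ 2 = 0 := fun i j => by
      rcases mul_eq_zero.mp (h0 i) with h | h <;> rcases mul_eq_zero.mp (h0 j) with h' | h' <;>
        simp [h, h']
    simp [h1, h2, ← ht']
  have hs' : 0 < s := by
    refine hs0.lt_of_ne fun h => ht'.ne' ?_
    have h0 : ∀ i, w i = 0 := fun i =>
      (Finset.sum_eq_zero_iff_of_nonneg fun i _ => hw i).mp (hs.symm.trans h.symm) i
        (Finset.mem_univ i)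
    simp [ht, h0]
  obtain ⟨m, hm⟩ : ∃ m, m = t / s := ⟨_, rfl⟩
  have hm0 : 0 < m := hm ▸ div_pos ht' hs'
  have hlog : Real.log m = Real.log t - Real.log s := hm ▸ Real.log_div ht'.ne' hs'.ne'
  -- The pairwise sum is `s` times the weighted variance of `√a`, which is at most `s` times the
  -- mean square deviation from any constant, here `√m`.
  have hvar : 1 / 2 * ∑ i, ∑ j, w i * w j / s * (√(a i) - √(a j)) ^ 2
      ≤ ∑ i, w i * (√(a i) - √m) ^ 2 := by
    have hpt : ∀ i j, w i * w j / s * (√(a i) - √(a j)) ^ 2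
        = w i / s * (√(a i) - √m) ^ 2 * w j + w i / s * (w j * (√(a j) - √m) ^ 2)
          - 2 / s * ((w i * (√(a i) - √m)) * (w j * (√(a j) - √m))) := fun i j => by ring
    simp_rw [hpt, Finset.sum_sub_distrib, Finset.sum_add_distrib, ← Finset.mul_sum,
      ← Finset.sum_mul, ← Finset.sum_div, ← hs]
    have e1 : ∑ i, w i / s * (√(a i) - √m) ^ 2 * s = ∑ i, w i * (√(a i) - √m) ^ 2 :=
      Finset.sum_congr rfl fun i _ => by field_simp
    rw [← Finset.sum_mul] at e1
    rw [div_self hs'.ne', e1]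
    have e2 : 0 ≤ 2 / s * ((∑ i, w i * (√(a i) - √m)) * ∑ i, w i * (√(a i) - √m)) :=
      mul_nonneg (by positivity) (mul_self_nonneg _)
    linarith
  have hkl : ∑ i, w i * (√(a i) - √m) ^ 2
      ≤ ∑ i, (w i * (a i * Real.log (a i)) - w i * a i * Real.log m - w i * a i + w i * m) := by
    refine Finset.sum_le_sum fun i _ => ?_
    have := mul_le_mul_of_nonneg_left (sq_sub_sqrt_le_mul_log (ha i) hm0) (hw i)
    linarith
  simp_rw [Finset.sum_add_distrib, Finset.sum_sub_distrib, ← Finset.sum_mul, ← ht, ← hs] at hkl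
  have hsm : s * m = t := by rw [hm]; field_simp
  have hneg : ∑ i, w i * negMulLog (a i) = -∑ i, w i * (a i * Real.log (a i)) := by
    rw [← Finset.sum_neg_distrib]
    exact Finset.sum_congr rfl fun i _ => by simp [negMulLog]
  rw [hneg, negMulLog]
  rw [hsm, hlog] at hkl
  linarith

variable {G : Type u} [AddCommGroup G] [Fintype G]

/-- Unnormalized entropy of a nonnegative vector. -/
noncomputable def unnormEntropy (v : G → ℝ) : ℝ := ∑ x, negMulLog (v x) - negMulLog (∑ x, v x)

/-- The cardinality of `G` times the conditional entropy of the uniform input given the output. -/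
noncomputable def equivocation (C : DMChannel G) : ℝ := ∑ y, unnormEntropy fun x => C.W x y

lemma equivocation_minus_eq (C : DMChannel G) :
    C.minus.equivocation = ∑ y₁, ∑ y₂, unnormEntropy fun u₁ : G =>
      ∑ u₂ : G, 1 / (Fintype.card G : ℝ) * C.W (u₁ + u₂) y₁ * C.W u₂ y₂ := by
  simp only [equivocation]
  rw [show (∑ y : C.minus.Out, unnormEntropy fun x => C.minus.W x y)
    = ∑ y : C.Out × C.Out, unnormEntropy fun x => C.minus.W x y from rfl, Fintype.sum_prod_type]
  rfl

lemma equivocation_plus_eq (C : DMChannel G) :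
    C.plus.equivocation = ∑ y₁, ∑ y₂, ∑ u₁ : G, unnormEntropy fun u₂ : G =>
      1 / (Fintype.card G : ℝ) * C.W (u₁ + u₂) y₁ * C.W u₂ y₂ := by
  simp only [equivocation]
  rw [show (∑ y : C.plus.Out, unnormEntropy fun x => C.plus.W x y)
    = ∑ y : C.Out × C.Out × G, unnormEntropy fun x => C.plus.W x y from rfl]
  simp_rw [Fintype.sum_prod_type]
  rfl

lemma sum_negMulLog_mul (c : ℝ) (f g : G → ℝ) :
    ∑ u, ∑ v, negMulLog (c * f (u + v) * g v)
      = c * ((∑ u, negMulLog (f u)) * ∑ v, g v) + c * ((∑ u, f u) * ∑ v, negMulLog (g v))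
        + negMulLog c * ((∑ u, f u) * ∑ v, g v) := by
  rw [← sum_sum_shift (fun u => negMulLog (f u)), ← sum_sum_shift f g,
    ← sum_sum_shift f fun v => negMulLog (g v)]
  simp_rw [Finset.mul_sum, ← Finset.sum_add_distrib]
  refine Finset.sum_congr rfl fun u _ => Finset.sum_congr rfl fun v _ => ?_
  rw [Real.negMulLog_mul, Real.negMulLog_mul]
  ring

/-- Chain rule for entropy: `(u₁, u₂) ↦ (u₁ + u₂, u₂)` is a bijection. The total masses subtracted
in the plus term are the entries of the minus term, so they cancel. -/
lemma equivocation_minus_add_plus (C : DMChannel G) :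
    C.minus.equivocation + C.plus.equivocation = 2 * C.equivocation := by
  have hq := card_pos_real (G := G)
  obtain ⟨q, hqdef⟩ : ∃ q : ℝ, q = (Fintype.card G : ℝ) := ⟨_, rfl⟩
  rw [equivocation_minus_eq, equivocation_plus_eq, ← hqdef]
  rw [← hqdef] at hq
  have key : ∀ y₁ y₂,
      (unnormEntropy fun u₁ : G => ∑ u₂ : G, 1 / q * C.W (u₁ + u₂) y₁ * C.W u₂ y₂)
        + ∑ u₁ : G, (unnormEntropy fun u₂ : G => 1 / q * C.W (u₁ + u₂) y₁ * C.W u₂ y₂)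
      = 1 / q * ((unnormEntropy fun x => C.W x y₁) * ∑ x, C.W x y₂)
        + 1 / q * ((∑ x, C.W x y₁) * unnormEntropy fun x => C.W x y₂) := by
    intro y₁ y₂
    simp only [unnormEntropy, Finset.sum_sub_distrib]
    rw [sum_negMulLog_mul (1 / q) (fun x => C.W x y₁) (fun x => C.W x y₂)]
    simp_rw [mul_assoc (1 / q), ← Finset.mul_sum]
    rw [sum_sum_shift (fun x => C.W x y₁) (fun x => C.W x y₂), Real.negMulLog_mul,
      Real.negMulLog_mul]
    ring
  have hsum : ∑ y, ∑ x, C.W x y = q := by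
    rw [Finset.sum_comm]; simp [C.sum_eq_one, hqdef]
  simp_rw [← Finset.sum_add_distrib, key, Finset.sum_add_distrib, ← Finset.mul_sum,
    ← Finset.sum_mul, hsum]
  simp only [equivocation]
  field_simp
  ring

lemma unnormEntropy_nonneg {v : G → ℝ} (hv : ∀ x, 0 ≤ v x) : 0 ≤ unnormEntropy v := by
  have h0 : 0 ≤ ∑ x, v x := Finset.sum_nonneg fun x _ => hv x
  rw [unnormEntropy, sub_nonneg, negMulLog, neg_mul, Finset.sum_mul, ← Finset.sum_neg_distrib]
  refine Finset.sum_le_sum fun x _ => ?_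
  rw [negMulLog, neg_mul, neg_le_neg_iff]
  rcases (hv x).eq_or_lt with h | h
  · simp [← h]
  · exact mul_le_mul_of_nonneg_left (Real.log_le_log h
      (Finset.single_le_sum (fun x _ => hv x) (Finset.mem_univ x))) (hv x)

lemma equivocation_nonneg (C : DMChannel G) : 0 ≤ C.equivocation :=
  Finset.sum_nonneg fun _ _ => unnormEntropy_nonneg fun _ => C.nonneg _ _

/-- Crude, from `log r ≤ r - 1`; only a uniform bound is needed. -/
lemma unnormEntropy_le {v : G → ℝ} (hv : ∀ x, 0 ≤ v x) :
    unnormEntropy v ≤ Fintype.card G * ∑ x, v x := by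
  have hs : ∀ x, v x ≤ ∑ x, v x := fun x =>
    Finset.single_le_sum (fun x _ => hv x) (Finset.mem_univ x)
  rw [unnormEntropy, negMulLog, neg_mul, Finset.sum_mul, sub_neg_eq_add,
    ← Finset.sum_add_distrib, ← nsmul_eq_mul, ← Finset.card_univ]
  refine Finset.sum_le_card_nsmul _ _ _ fun x _ => ?_
  rw [negMulLog]
  generalize ∑ x, v x = s at hs
  rcases (hv x).eq_or_lt with h | h
  · simpa [← h] using (hv x).trans (hs x)
  · have hs0 : 0 < s := h.trans_le (hs x)
    have := mul_le_mul_of_nonneg_left (Real.log_le_sub_one_of_pos (div_pos hs0 h)) h.le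
    rw [Real.log_div hs0.ne' h.ne', mul_sub, mul_sub, mul_div_cancel₀ _ h.ne'] at this
    linarith

lemma equivocation_le (C : DMChannel G) : C.equivocation ≤ (Fintype.card G : ℝ) ^ 2 := by
  refine (Finset.sum_le_sum fun y _ => unnormEntropy_le fun x => C.nonneg x y).trans ?_
  rw [← Finset.mul_sum, Finset.sum_comm]
  simp [C.sum_eq_one, sq]

/-- Given `(y₁, y₂)`, the minus likelihood is a mixture of translates of `x ↦ W(y₁|x)` with weights
`W(y₂|u) / q`. The Jensen gap controls Hellinger distances between translates; those between `u` and
`u + d` contribute `1 - Z_d` times a collision weight of `d`, which is at least `Z_d²`. -/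
lemma one_sub_Zd_mul_sq_le (C : DMChannel G) (d : G) :
    C.Zd d ^ 2 * (1 - C.Zd d) ≤ C.minus.equivocation - C.equivocation := by
  have hq := card_pos_real (G := G)
  obtain ⟨q, hqdef⟩ : ∃ q : ℝ, q = (Fintype.card G : ℝ) := ⟨_, rfl⟩
  rw [← hqdef] at hq
  have hpt : ∀ y₁ y₂, (∑ u, C.W u y₂) / q * (unnormEntropy fun x => C.W x y₁)
      + 1 / 2 * ∑ u, C.W u y₂ * C.W (u + d) y₂ / (q * ∑ v, C.W v y₂)
        * ∑ x, (√(C.W x y₁) - √(C.W (x + d) y₁)) ^ 2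
      ≤ unnormEntropy fun u₁ : G => ∑ u₂ : G, 1 / q * C.W (u₁ + u₂) y₁ * C.W u₂ y₂ := by
    intro y₁ y₂
    obtain ⟨s, hs⟩ : ∃ s, s = ∑ u, C.W u y₂ / q := ⟨_, rfl⟩
    have hs' : s * q = ∑ v, C.W v y₂ := by rw [hs, ← Finset.sum_div]; field_simp
    have hw : ∀ u, 0 ≤ C.W u y₂ / q := fun u => div_nonneg (C.nonneg _ _) hq.le
    have hs0 : 0 ≤ s := hs ▸ Finset.sum_nonneg fun u _ => hw u
    have hj : ∀ u₁ : G, ∑ u, C.W u y₂ / q * negMulLog (C.W (u₁ + u) y₁)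
        - (∑ u, C.W u y₂ / q * C.W (u₁ + u) y₁) * Real.log s
        + 1 / 2 * ∑ u, C.W u y₂ * C.W (u + d) y₂ / (q * ∑ v, C.W v y₂)
          * (√(C.W (u₁ + u) y₁) - √(C.W (u₁ + u + d) y₁)) ^ 2
        ≤ negMulLog (∑ u, 1 / q * C.W (u₁ + u) y₁ * C.W u y₂) := by
      intro u₁
      have := jensen_gap_negMulLog (fun u => C.W u y₂ / q) (fun u => C.W (u₁ + u) y₁) hw
        (fun u => C.nonneg _ _)
      rw [← hs] at this
      have e : ∑ u, 1 / q * C.W (u₁ + u) y₁ * C.W u y₂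
          = ∑ u, C.W u y₂ / q * C.W (u₁ + u) y₁ := Finset.sum_congr rfl fun u _ => by ring
      rw [e]
      refine le_trans ?_ this
      gcongr with u
      -- Of all pairs `(u, j)` in the Jensen gap, only `j = u + d` is kept.
      refine le_trans (le_of_eq ?_) (Finset.single_le_sum (f := fun j => C.W u y₂ / q *
        (C.W j y₂ / q) / s * (√(C.W (u₁ + u) y₁) - √(C.W (u₁ + j) y₁)) ^ 2)
        (fun j _ => mul_nonneg (div_nonneg (mul_nonneg (hw _) (hw _)) hs0) (sq_nonneg _))
        (Finset.mem_univ (u + d)))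
      rw [← hs', add_assoc u₁ u d]
      congr 1
      rw [div_mul_div_comm, div_div]
      congr 1
      ring
    have hsum := Finset.sum_le_sum fun u₁ (_ : u₁ ∈ (Finset.univ : Finset G)) => hj u₁
    simp_rw [Finset.sum_add_distrib, Finset.sum_sub_distrib, ← Finset.sum_mul,
      ← Finset.mul_sum] at hsum
    have r1 : ∀ f : G → ℝ, ∑ u₁ : G, ∑ u, C.W u y₂ / q * f (u₁ + u) = (∑ u, f u) * s := by
      intro f
      rw [hs, ← sum_sum_shift f]
      simp_rw [mul_comm (f _)]
    have r2 : ∑ u₁ : G, ∑ u, C.W u y₂ * C.W (u + d) y₂ / (q * ∑ v, C.W v y₂)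
          * (√(C.W (u₁ + u) y₁) - √(C.W (u₁ + u + d) y₁)) ^ 2
        = ∑ u, C.W u y₂ * C.W (u + d) y₂ / (q * ∑ v, C.W v y₂)
          * ∑ x, (√(C.W x y₁) - √(C.W (x + d) y₁)) ^ 2 := by
      rw [Finset.sum_comm]
      refine Finset.sum_congr rfl fun u _ => ?_
      rw [← Finset.mul_sum, sum_add_right_eq (fun x => (√(C.W x y₁) - √(C.W (x + d) y₁)) ^ 2) u]
    rw [r1 (fun x => negMulLog (C.W x y₁)), r1 (fun x => C.W x y₁), r2] at hsum
    have r3 : ∑ u₁ : G, ∑ u, 1 / q * C.W (u₁ + u) y₁ * C.W u y₂ = (∑ x, C.W x y₁) * s := by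
      rw [← r1]
      exact Finset.sum_congr rfl fun _ _ => Finset.sum_congr rfl fun _ _ => by ring
    simp only [unnormEntropy]
    rw [r3, Real.negMulLog_mul, ← hs', mul_div_cancel_right₀ _ hq.ne']
    have : negMulLog s = -(s * Real.log s) := by simp [negMulLog]
    rw [this, hs']
    linarith
  -- Cauchy–Schwarz over pairs (output, input); the weights `∑ v, W(y|v)` total `q²`. Outputs of
  -- zero weight are harmless, their quotient being `0 / 0 = 0`.
  have hk : C.Zd d ^ 2 ≤ ∑ y, ∑ u, C.W u y * C.W (u + d) y / ∑ v, C.W v y := by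
    have hcs := Finset.sum_sq_le_sum_mul_sum_of_sq_le_mul (R := ℝ)
      (Finset.univ : Finset (C.Out × G))
      (r := fun z => √(C.W z.2 z.1 * C.W (z.2 + d) z.1))
      (f := fun z => C.W z.2 z.1 * C.W (z.2 + d) z.1 / ∑ v, C.W v z.1)
      (g := fun z => ∑ v, C.W v z.1)
      (fun z _ => div_nonneg (mul_nonneg (C.nonneg _ _) (C.nonneg _ _))
        (Finset.sum_nonneg fun _ _ => C.nonneg _ _))
      (fun z _ => Finset.sum_nonneg fun _ _ => C.nonneg _ _)
      (fun z _ => by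
        rw [Real.sq_sqrt (mul_nonneg (C.nonneg _ _) (C.nonneg _ _))]
        rcases eq_or_ne (∑ v, C.W v z.1) 0 with h | h
        · have : C.W z.2 z.1 = 0 := (Finset.sum_eq_zero_iff_of_nonneg
            fun v _ => C.nonneg v z.1).mp h z.2 (Finset.mem_univ _)
          simp [this]
        · rw [div_mul_cancel₀ _ h])
    simp_rw [Fintype.sum_prod_type] at hcs
    have e1 : ∑ y, ∑ u, √(C.W u y * C.W (u + d) y) = q * C.Zd d := by
      rw [Finset.sum_comm, hqdef, card_mul_Zd]; rfl
    have e2 : ∑ y, ∑ _u : G, ∑ v, C.W v y = q ^ 2 := by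
      rw [Finset.sum_comm]
      have : ∑ y, ∑ v, C.W v y = q := by
        rw [Finset.sum_comm]; simp [C.sum_eq_one, hqdef]
      simp_rw [this]
      simp [hqdef, sq]
    rw [e1, e2, mul_pow, mul_comm] at hcs
    exact le_of_mul_le_mul_right hcs (by positivity)
  have hsum := Finset.sum_le_sum fun y₁ (_ : y₁ ∈ (Finset.univ : Finset C.Out)) =>
    Finset.sum_le_sum fun y₂ (_ : y₂ ∈ (Finset.univ : Finset C.Out)) => hpt y₁ y₂
  have hq1 : ∑ y, ∑ x, C.W x y = q := by
    rw [Finset.sum_comm]; simp [C.sum_eq_one, hqdef]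
  have hH : ∑ y, ∑ x, (√(C.W x y) - √(C.W (x + d) y)) ^ 2 = 2 * q * (1 - C.Zd d) := by
    rw [Finset.sum_comm, hqdef, C.sum_hellinger_eq]
  rw [hqdef, ← C.equivocation_minus_eq, ← hqdef] at hsum
  have e3 : ∑ y₁, ∑ y₂, (∑ u, C.W u y₂) / q * (unnormEntropy fun x => C.W x y₁)
      = C.equivocation := by
    simp_rw [← Finset.sum_mul, ← Finset.sum_div, hq1, div_self hq.ne', one_mul]
    rfl
  have e4 : ∑ y₁, ∑ y₂, 1 / 2 * ∑ u, C.W u y₂ * C.W (u + d) y₂ / (q * ∑ v, C.W v y₂)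
        * ∑ x, (√(C.W x y₁) - √(C.W (x + d) y₁)) ^ 2
      = (1 - C.Zd d) * ∑ y, ∑ u, C.W u y * C.W (u + d) y / ∑ v, C.W v y := by
    simp_rw [← Finset.mul_sum, ← Finset.sum_mul]
    rw [← Finset.mul_sum, hH, Finset.mul_sum, Finset.sum_mul, Finset.mul_sum]
    refine Finset.sum_congr rfl fun y _ => ?_
    simp_rw [Finset.sum_mul, Finset.mul_sum]
    refine Finset.sum_congr rfl fun u _ => ?_
    rw [← Finset.mul_sum, mul_comm q, ← div_div]
    field_simp
  simp_rw [Finset.sum_add_distrib] at hsum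
  rw [e3, e4] at hsum
  have := mul_le_mul_of_nonneg_left hk (sub_nonneg.mpr (C.Zd_le_one d))
  linarith

end DMChannel

/-! ### Fast polarization along a deterministic sequence -/

section Rate

/-- The number of times `k < n` at which the predicate `p` holds. -/
def goodCount (p : ℕ → Bool) (n : ℕ) : ℕ := ∑ k ∈ Finset.range n, (p k).toNat

lemma goodCount_succ (p : ℕ → Bool) (n : ℕ) :
    goodCount p (n + 1) = goodCount p n + (p n).toNat := Finset.sum_range_succ _ _

lemma goodCount_add_le (p : ℕ → Bool) (m k : ℕ) : goodCount p (m + k) ≤ goodCount p m + k := by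
  induction k with
  | zero => simp
  | succ k ih =>
    rw [← add_assoc, goodCount_succ]
    have := Bool.toNat_le (p (m + k))
    omega

lemma goodCount_mono (p : ℕ → Bool) : Monotone (goodCount p) :=
  monotone_nat_of_le_succ fun n => by rw [goodCount_succ]; omega

lemma goodCount_le (p : ℕ → Bool) (n : ℕ) : goodCount p n ≤ n := by
  simpa [goodCount] using goodCount_add_le p 0 n

variable {p : ℕ → Bool} {A : ℝ} {v : ℕ → ℝ}

lemma le_pow_goodCount_of_le (hA : 1 ≤ A) (hv : ∀ n, 0 ≤ v n)
    (hbad : ∀ n, p n = false → v (n + 1) ≤ A * v n) {δ : ℝ} (hδ : 0 ≤ δ) {N : ℕ}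
    (hgood : ∀ n ≥ N, p n = true → v (n + 1) ≤ δ * v n) (k : ℕ) :
    v (N + k) ≤ δ ^ (goodCount p (N + k) - goodCount p N) * A ^ k * v N := by
  induction k with
  | zero => simp
  | succ k ih =>
    have hm := goodCount_mono p (Nat.le_add_right N k)
    rw [← add_assoc, goodCount_succ]
    have hAk : 1 ≤ A ^ k := one_le_pow₀ hA
    have hX : 0 ≤ δ ^ (goodCount p (N + k) - goodCount p N) * A ^ k * v N := by
      have := hv N; positivity
    cases hp : p (N + k) with
    | false =>
      refine (hbad _ hp).trans ((mul_le_mul_of_nonneg_left ih (by linarith)).trans (le_of_eq ?_))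
      simp only [Bool.toNat_false, add_zero]; ring
    | true =>
      refine (hgood _ (by omega) hp).trans ((mul_le_mul_of_nonneg_left ih hδ).trans ?_)
      simp only [Bool.toNat_true]
      rw [show goodCount p (N + k) + 1 - goodCount p N
        = goodCount p (N + k) - goodCount p N + 1 by omega, pow_succ, pow_succ]
      have := mul_le_mul_of_nonneg_left (mul_le_mul_of_nonneg_left hA hX) hδ
      linarith

/-- A good step doubles the exponent. A bad step costs a factor `A`, absorbed by enlarging the base
since `A ≤ A ^ 2 ^ l`. -/
lemma le_pow_two_pow_goodCount (hA : 1 ≤ A) (hv : ∀ n, 0 ≤ v n)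
    (hbad : ∀ n, p n = false → v (n + 1) ≤ A * v n)
    (hgood : ∀ n, p n = true → v (n + 1) ≤ v n ^ 2) (m k : ℕ) :
    v (m + k) ≤ (A ^ k * v m) ^ 2 ^ (goodCount p (m + k) - goodCount p m) := by
  induction k with
  | zero => simp
  | succ k ih =>
    have hm := goodCount_mono p (Nat.le_add_right m k)
    rw [← add_assoc, goodCount_succ]
    have hA0 : 0 ≤ A := by linarith
    have hX : 0 ≤ A ^ k * v m := mul_nonneg (by positivity) (hv m)
    cases hp : p (m + k) with
    | false =>
      refine (hbad _ hp).trans ((mul_le_mul_of_nonneg_left ih (by linarith)).trans ?_)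
      simp only [Bool.toNat_false, add_zero]
      rw [pow_succ, mul_right_comm, mul_pow (A ^ k * v m), mul_comm A]
      exact mul_le_mul_of_nonneg_left (le_self_pow₀ hA (by positivity)) (by positivity)
    | true =>
      refine (hgood _ hp).trans ?_
      simp only [Bool.toNat_true]
      rw [show goodCount p (m + k) + 1 - goodCount p m
        = goodCount p (m + k) - goodCount p m + 1 by omega, pow_succ 2, pow_mul]
      refine pow_le_pow_left₀ (hv _) (ih.trans ?_) 2
      refine pow_le_pow_left₀ hX ?_ _
      rw [pow_succ, mul_right_comm]
      exact le_mul_of_one_le_right hX hA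

lemma eventually_le_pow (hA : 1 ≤ A) (hv : ∀ n, 0 ≤ v n)
    (hbad : ∀ n, p n = false → v (n + 1) ≤ A * v n)
    (hgood : ∀ n, p n = true → v (n + 1) ≤ v n ^ 2)
    (hlim : Tendsto v atTop (𝓝 0))
    (hp : Tendsto (fun n : ℕ => (goodCount p n : ℝ) / n) atTop (𝓝 (1 / 2)))
    {ε : ℝ} (hε : 0 < ε) (hε1 : ε ≤ 1) : ∀ᶠ n in atTop, v n ≤ ε ^ n := by
  have hA0 : 0 < A := by linarith
  -- Once `v < c ^ 4`, each good step gains `c ^ 4`. With at least a quarter of `n` good steps the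
  -- gain is `c ^ n`, and `c ^ n * A ^ n = ε ^ n`.
  set c := ε / A with hc
  have hc0 : 0 < c := by positivity
  have hc1 : c ≤ 1 := by rw [hc, div_le_one hA0]; linarith
  have hδ : 0 < c ^ 4 := by positivity
  obtain ⟨N, hN⟩ := eventually_atTop.mp (hlim.eventually (gt_mem_nhds hδ))
  have hvN : v N ≤ 1 := (hN N le_rfl).le.trans (pow_le_one₀ hc0.le hc1)
  have h3 : ∀ᶠ n : ℕ in atTop, (1 / 3 : ℝ) < (goodCount p n : ℝ) / n :=
    hp.eventually (lt_mem_nhds (by norm_num))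
  -- Up to `N` good steps are discarded, and `n / 3 - N ≥ n / 4` once `n ≥ 12 N`.
  filter_upwards [h3, eventually_ge_atTop (12 * N + 1)] with n hn hnN
  obtain ⟨k, rfl⟩ := Nat.exists_eq_add_of_le (show N ≤ n by omega)
  have hb := le_pow_goodCount_of_le hA hv hbad hδ.le (N := N) (fun n hn hp => by
    refine (hgood n hp).trans ?_
    rw [sq]
    exact mul_le_mul_of_nonneg_right (hN n hn).le (hv n)) k
  have hpos : (0 : ℝ) < ((N + k : ℕ) : ℝ) := by exact_mod_cast (by omega : 0 < N + k)
  rw [lt_div_iff₀ hpos] at hn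
  have hn' : N + k < 3 * goodCount p (N + k) := by
    have : ((N + k : ℕ) : ℝ) < 3 * (goodCount p (N + k) : ℝ) := by linarith
    exact_mod_cast this
  have hgN := goodCount_le p N
  have hge : N + k ≤ 4 * (goodCount p (N + k) - goodCount p N) := by omega
  refine hb.trans ?_
  have hA' : A ^ k ≤ A ^ (N + k) := pow_le_pow_right₀ hA (by omega)
  calc (c ^ 4) ^ (goodCount p (N + k) - goodCount p N) * A ^ k * v N
      ≤ (c ^ 4) ^ (goodCount p (N + k) - goodCount p N) * A ^ k * 1 :=
        mul_le_mul_of_nonneg_left hvN (by positivity)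
    _ ≤ c ^ (N + k) * A ^ (N + k) := by
        rw [mul_one, ← pow_mul]
        exact mul_le_mul (pow_le_pow_of_le_one hc0.le hc1 hge) hA' (by positivity) (by positivity)
    _ = ε ^ (N + k) := by rw [← mul_pow, hc, div_mul_cancel₀ _ hA0.ne']

/-- Fast polarization along a path: if `x` is at least squared (up to a constant) at the good
steps, grows at most by a constant factor at the others, tends to zero, and half of the steps
are good, then `x n` is eventually smaller than `2 ^ (-2 ^ (β n))` for every `β < 1 / 2`. -/
theorem eventually_lt_two_rpow_neg {x : ℕ → ℝ} (hA : 1 ≤ A) (hx : ∀ n, 0 ≤ x n)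
    (hbad : ∀ n, p n = false → x (n + 1) ≤ A * x n)
    (hgood : ∀ n, p n = true → x (n + 1) ≤ A * x n ^ 2)
    (hlim : Tendsto x atTop (𝓝 0))
    (hp : Tendsto (fun n : ℕ => (goodCount p n : ℝ) / n) atTop (𝓝 (1 / 2)))
    {β : ℝ} (hβ : β < 1 / 2) :
    ∀ᶠ n : ℕ in atTop, x n < (2 : ℝ) ^ (-((2 : ℝ) ^ (β * (n : ℝ)))) := by
  have hA0 : 0 < A := by linarith
  -- This scaling turns `A * x ^ 2` into `v ^ 2`.
  set v : ℕ → ℝ := fun n => A * x n with hvdef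
  have hv : ∀ n, 0 ≤ v n := fun n => mul_nonneg hA0.le (hx n)
  have hvbad : ∀ n, p n = false → v (n + 1) ≤ A * v n := fun n h =>
    mul_le_mul_of_nonneg_left (hbad n h) hA0.le
  have hvgood : ∀ n, p n = true → v (n + 1) ≤ v n ^ 2 := fun n h => by
    refine (mul_le_mul_of_nonneg_left (hgood n h) hA0.le).trans (le_of_eq ?_)
    simp only [hvdef]; ring
  have hvlim : Tendsto v atTop (𝓝 0) := by simpa using hlim.const_mul A
  -- Two stages, split at `m ≈ n / M`. The first makes `v m ≤ (2A)^(-Mm) ≤ (2A)^(-n)`, which absorbs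
  -- every later factor `A`. The good steps of the second number at least `n / 2 - n / M - m ≥ n / 2
  -- - 3n / M`, hence at least `β n`.
  obtain ⟨M, hM'⟩ := exists_nat_gt (max (4 / (1 / 2 - β)) 2)
  have hM := (le_max_left _ _).trans_lt hM'
  have hM2 : (2 : ℝ) < M := (le_max_right _ _).trans_lt hM'
  have hMpos : (0 : ℝ) < M := lt_trans (div_pos (by norm_num) (by linarith)) hM
  have hM0 : 0 < M := by exact_mod_cast hMpos
  have hε0 : (0 : ℝ) < (1 / (2 * A)) ^ M := by positivity
  have h2A : 1 / (2 * A) ≤ 1 := by rw [div_le_one (by positivity)]; linarith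
  have hpow := eventually_le_pow hA hv hvbad hvgood hvlim hp hε0
    (pow_le_one₀ (by positivity) h2A)
  have hm : Tendsto (fun n : ℕ => n / M + 1) atTop atTop :=
    tendsto_atTop_mono (fun n => Nat.le_succ _) (Nat.tendsto_div_const_atTop hM0.ne')
  have hM4 : 4 / M < 1 / 2 - β := by
    rw [div_lt_iff₀ (by linarith)] at hM
    rw [div_lt_iff₀ hMpos]; linarith
  have h3 : ∀ᶠ n : ℕ in atTop, (1 / 2 - 1 / M : ℝ) < (goodCount p n : ℝ) / n :=
    hp.eventually (lt_mem_nhds (by linarith [one_div_pos.mpr hMpos]))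
  filter_upwards [hm.eventually hpow, h3, eventually_ge_atTop (M + 2)] with n hn1 hn2 hn3
  have hn3' : (M : ℝ) + 2 ≤ n := by exact_mod_cast hn3
  have hn0 : (0 : ℝ) < n := by linarith
  obtain ⟨m, hmdef⟩ : ∃ m, m = n / M + 1 := ⟨_, rfl⟩
  rw [← hmdef] at hn1
  have hmn : m ≤ n := by
    have : n / M < n := Nat.div_lt_self (by omega) (by exact_mod_cast (by linarith : (1 : ℝ) < M))
    omega
  have hnM : n ≤ M * m := by
    have h1 := Nat.div_add_mod n M
    have h2 := Nat.mod_lt n hM0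
    rw [hmdef, mul_add]
    omega
  have hmle : (m : ℝ) ≤ n / M + 1 := by
    rw [hmdef]; push_cast
    gcongr
    exact Nat.cast_div_le
  obtain ⟨k, rfl⟩ := Nat.exists_eq_add_of_le hmn
  obtain ⟨l, hl⟩ : ∃ l, l = goodCount p (m + k) - goodCount p m := ⟨_, rfl⟩
  have hb := le_pow_two_pow_goodCount hA hv hvbad hvgood m k
  rw [← hl] at hb
  have hbase : A ^ k * v m ≤ 1 / 4 := by
    calc A ^ k * v m ≤ A ^ (m + k) * (1 / (2 * A)) ^ (m + k) := by
          refine mul_le_mul (pow_le_pow_right₀ hA (by omega)) (hn1.trans ?_) (hv m) (by positivity)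
          rw [← pow_mul]
          exact pow_le_pow_of_le_one (by positivity) h2A hnM
      _ = (1 / 2) ^ (m + k) := by
          rw [← mul_pow]; congr 1; field_simp
      _ ≤ (1 / 2) ^ 2 := pow_le_pow_of_le_one (by norm_num) (by norm_num) (by omega)
      _ = 1 / 4 := by norm_num
  have hlβ : β * ((m + k : ℕ) : ℝ) ≤ l := by
    have hgm := goodCount_le p m
    have hl' : (goodCount p (m + k) : ℝ) - m ≤ l := by
      have : goodCount p (m + k) ≤ l + m := by omega
      have : (goodCount p (m + k) : ℝ) ≤ l + m := by exact_mod_cast this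
      linarith
    generalize ((m + k : ℕ) : ℝ) = t at *
    rw [lt_div_iff₀ hn0] at hn2
    have h5 : 1 ≤ t / M := by rw [le_div_iff₀ hMpos]; linarith
    have h6 : 4 / M * t ≤ (1 / 2 - β) * t := mul_le_mul_of_nonneg_right hM4.le hn0.le
    have h7 : 4 / M * t = 4 * (t / M) := by ring
    have h8 : 1 / M * t = t / M := by ring
    linarith
  have hxv : x (m + k) ≤ v (m + k) := le_mul_of_one_le_left (hx _) hA
  calc x (m + k) ≤ (A ^ k * v m) ^ 2 ^ l := hxv.trans hb
    _ ≤ (1 / 4) ^ 2 ^ l := pow_le_pow_left₀ (mul_nonneg (by positivity) (hv m)) hbase _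
    _ < (1 / 2) ^ 2 ^ l := pow_lt_pow_left₀ (by norm_num) (by norm_num) (by positivity)
    _ = (2 : ℝ) ^ (-((2 : ℝ) ^ (l : ℝ))) := by
        rw [Real.rpow_neg (by norm_num), Real.rpow_natCast, one_div, inv_pow]
        norm_cast
    _ ≤ (2 : ℝ) ^ (-((2 : ℝ) ^ (β * ((m + k : ℕ) : ℝ)))) := by
        refine Real.rpow_le_rpow_of_exponent_le (by norm_num) (neg_le_neg ?_)
        exact Real.rpow_le_rpow_of_exponent_le (by norm_num) hlβ

end Rate

/-! ### Zero-one dichotomy and comparison with the threshold -/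

/-- On `[1/4, 3/4]` the function `z² (1 - z)` is at least `3/64`, so this interval is eventually
avoided. From above `3/4` the next value exceeds `9/16`, so the upper region is never left again. -/
lemma tendsto_zero_or_one_of_sq_mul_one_sub {z : ℕ → ℝ} (h0 : ∀ n, 0 ≤ z n) (h1 : ∀ n, z n ≤ 1)
    (hstep : ∀ n, z n ^ 2 ≤ z (n + 1))
    (hlim : Tendsto (fun n => z n ^ 2 * (1 - z n)) atTop (𝓝 0)) :
    Tendsto z atTop (𝓝 0) ∨ Tendsto z atTop (𝓝 1) := by
  obtain ⟨N, hN⟩ := eventually_atTop.mp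
    (hlim.eventually (gt_mem_nhds (show (0 : ℝ) < 3 / 64 by norm_num)))
  have hdich : ∀ n ≥ N, z n < 1 / 4 ∨ 3 / 4 < z n := by
    intro n hn
    by_contra! hc
    have := hN n hn
    have h2 : (1 / 4 : ℝ) ^ 2 ≤ z n ^ 2 := pow_le_pow_left₀ (by norm_num) hc.1 2
    rcases le_total (z n) (1 / 2) with h | h
    · nlinarith
    · nlinarith
  by_cases hex : ∃ m ≥ N, 3 / 4 < z m
  · obtain ⟨m, hm, hzm⟩ := hex
    have hstay : ∀ n ≥ m, 3 / 4 < z n := by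
      intro n hn
      induction n, hn using Nat.le_induction with
      | base => exact hzm
      | succ n hn ih =>
        refine (hdich (n + 1) (by omega)).resolve_left fun h => ?_
        have := hstep n
        nlinarith
    right
    have : Tendsto (fun n => 1 - z n) atTop (𝓝 0) := by
      refine squeeze_zero' (Eventually.of_forall fun n => sub_nonneg.mpr (h1 n))
        (eventually_atTop.mpr ⟨m, fun n hn => ?_⟩) (by simpa using hlim.const_mul 2)
      have h3 := hstay n hn
      have h4 : (1 : ℝ) ≤ 2 * z n ^ 2 := by nlinarith
      have h5 := mul_le_mul_of_nonneg_right h4 (sub_nonneg.mpr (h1 n))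
      linarith
    simpa using this.const_sub 1
  · push Not at hex
    left
    have : Tendsto (fun n => z n ^ 2) atTop (𝓝 0) := by
      refine squeeze_zero' (Eventually.of_forall fun n => sq_nonneg _)
        (eventually_atTop.mpr ⟨N, fun n hn => ?_⟩) (by simpa using hlim.const_mul 2)
      have h3 := (hdich n hn).resolve_right (not_lt.mpr (hex n hn))
      nlinarith [sq_nonneg (z n)]
    have h := this.sqrt
    simpa [Real.sqrt_sq (h0 _)] using h

/-- Matters for `β < 0`: the threshold then approaches 1, but only exponentially fast, with gap at
least `2^(β n) / 4`, against a doubly exponential left side. -/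
lemma eventually_two_rpow_neg_le_one_sub (β : ℝ) :
    ∀ᶠ n : ℕ in atTop, (2 : ℝ) ^ (-((2 : ℝ) ^ (1 / 4 * (n : ℝ))))
      ≤ 1 - (2 : ℝ) ^ (-((2 : ℝ) ^ (β * (n : ℝ)))) := by
  obtain ⟨γ, hγ⟩ : ∃ γ, γ = min β 0 := ⟨_, rfl⟩
  have hγβ : γ ≤ β := hγ ▸ min_le_left _ _
  have hγ0 : γ ≤ 0 := hγ ▸ min_le_right _ _
  have hr : (1 : ℝ) < 2 ^ (1 / 4 : ℝ) := Real.one_lt_rpow (by norm_num) (by norm_num)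
  have hlim := tendsto_pow_const_div_const_pow_of_one_lt 1 hr
  have hpos : (0 : ℝ) < 1 / (2 - γ) := one_div_pos.mpr (by linarith)
  filter_upwards [hlim.eventually (gt_mem_nhds hpos), eventually_ge_atTop 1] with n hn hn1
  have hn1' : (1 : ℝ) ≤ n := by exact_mod_cast hn1
  have hgrow : 2 - γ * n ≤ (2 : ℝ) ^ (1 / 4 * (n : ℝ)) := by
    rw [div_lt_div_iff₀ (by positivity) (by linarith), pow_one, one_mul,
      ← Real.rpow_mul_natCast (by norm_num)] at hn
    nlinarith
  obtain ⟨t, ht⟩ : ∃ t, t = (2 : ℝ) ^ (γ * (n : ℝ)) := ⟨_, rfl⟩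
  have ht0 : 0 < t := ht ▸ Real.rpow_pos_of_pos (by norm_num) _
  have ht1 : t ≤ 1 := by
    rw [ht]
    exact Real.rpow_le_one_of_one_le_of_nonpos (by norm_num)
      (mul_nonpos_of_nonpos_of_nonneg hγ0 (by linarith))
  have htβ : t ≤ (2 : ℝ) ^ (β * (n : ℝ)) := by
    rw [ht]
    exact Real.rpow_le_rpow_of_exponent_le (by norm_num)
      (mul_le_mul_of_nonneg_right hγβ (by linarith))
  have hlow : (2 : ℝ) ^ (-((2 : ℝ) ^ (1 / 4 * (n : ℝ)))) ≤ t / 4 := by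
    calc (2 : ℝ) ^ (-((2 : ℝ) ^ (1 / 4 * (n : ℝ)))) ≤ (2 : ℝ) ^ (γ * n - 2) :=
          Real.rpow_le_rpow_of_exponent_le (by norm_num) (by linarith)
      _ = t / 4 := by rw [Real.rpow_sub (by norm_num), ← ht]; norm_num
  have hexp : 1 + t / 2 ≤ (2 : ℝ) ^ t := by
    rw [Real.rpow_def_of_pos (by norm_num)]
    have := Real.add_one_le_exp (Real.log 2 * t)
    have := Real.log_two_gt_d9
    nlinarith
  have hhigh : (2 : ℝ) ^ (-((2 : ℝ) ^ (β * (n : ℝ)))) ≤ 1 - t / 4 := by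
    calc (2 : ℝ) ^ (-((2 : ℝ) ^ (β * (n : ℝ)))) ≤ (2 : ℝ) ^ (-t) :=
          Real.rpow_le_rpow_of_exponent_le (by norm_num) (neg_le_neg htβ)
      _ = ((2 : ℝ) ^ t)⁻¹ := Real.rpow_neg (by norm_num) _
      _ ≤ (1 + t / 2)⁻¹ := inv_anti₀ (by linarith) hexp
      _ ≤ 1 - t / 4 := by
          rw [inv_eq_one_div, div_le_iff₀ (by linarith)]
          nlinarith
  linarith

/-! ### Limits along one path of bits -/

namespace DMChannel

variable {G : Type u} [AddCommGroup G] [Fintype G]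

/-- The channel reached after `n` polarization steps along the bit sequence `b`. -/
noncomputable def polarPath (C : DMChannel G) (b : ℕ → Bool) (n : ℕ) : DMChannel G :=
  C.synth n (polarIndex b n)

lemma synth_succ_bit (C : DMChannel G) (n i : ℕ) (b : Bool) :
    C.synth (n + 1) (2 * i + b.toNat) = if b then (C.synth n i).plus else (C.synth n i).minus := by
  cases b
  · simp [synth]
  · simp [synth, Nat.add_mod, show (2 * i + 1) / 2 = i by omega]

lemma polarPath_succ_true (C : DMChannel G) {b : ℕ → Bool} {n : ℕ} (h : b n = true) :
    C.polarPath b (n + 1) = (C.polarPath b n).plus := by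
  simp only [polarPath, polarIndex, synth_succ_bit, h, if_true]

lemma polarPath_succ_false (C : DMChannel G) {b : ℕ → Bool} {n : ℕ} (h : b n = false) :
    C.polarPath b (n + 1) = (C.polarPath b n).minus := by
  simp only [polarPath, polarIndex, synth_succ_bit, h, Bool.false_eq_true, if_false]

variable (C : DMChannel G) (b : ℕ → Bool)

lemma Zd_polarPath_dichotomy
    (hD : Tendsto (fun n => (C.polarPath b n).minus.equivocation - (C.polarPath b n).equivocation)
      atTop (𝓝 0)) (d : G) :
    Tendsto (fun n => (C.polarPath b n).Zd d) atTop (𝓝 0)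
      ∨ Tendsto (fun n => (C.polarPath b n).Zd d) atTop (𝓝 1) := by
  refine tendsto_zero_or_one_of_sq_mul_one_sub (fun n => Zd_nonneg _ _) (fun n => Zd_le_one _ _)
    (fun n => ?_) ?_
  · cases h : b n with
    | true => rw [C.polarPath_succ_true h, Zd_plus]
    | false =>
      rw [C.polarPath_succ_false h]
      refine le_trans ?_ (Zd_le_Zd_minus _ d)
      exact pow_le_of_le_one (Zd_nonneg _ _) (Zd_le_one _ _) two_ne_zero
  · exact squeeze_zero (fun n => mul_nonneg (sq_nonneg _) (sub_nonneg.mpr (Zd_le_one _ _)))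
      (fun n => one_sub_Zd_mul_sq_le _ d) hD

/-- The subgroup of the shifts whose Bhattacharyya parameter tends to one along a path. -/
def limitSubgroup : AddSubgroup G where
  carrier := {d | Tendsto (fun n => (C.polarPath b n).Zd d) atTop (𝓝 1)}
  zero_mem' := by simp [Zd_zero]
  neg_mem' := by simp [Zd_neg]
  add_mem' := by
    intro d e hd he
    have h : Tendsto (fun n => 1 - (C.polarPath b n).Zd (d + e)) atTop (𝓝 0) := by
      refine squeeze_zero (fun n => sub_nonneg.mpr (Zd_le_one _ _))
        (fun n => one_sub_Zd_add_le _ d e) ?_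
      simpa using ((hd.const_sub 1).const_mul 2).add ((he.const_sub 1).const_mul 2)
    simpa using h.const_sub 1

lemma mem_limitSubgroup {d : G} :
    d ∈ C.limitSubgroup b ↔ Tendsto (fun n => (C.polarPath b n).Zd d) atTop (𝓝 1) := Iff.rfl

variable {C b}

lemma eventually_ZH_lt {H : AddSubgroup G}
    (hb : Tendsto (fun n : ℕ => (goodCount b n : ℝ) / n) atTop (𝓝 (1 / 2)))
    (hlim : Tendsto (fun n => (C.polarPath b n).ZH H) atTop (𝓝 0)) {β : ℝ} (hβ : β < 1 / 2) :
    ∀ᶠ n : ℕ in atTop, (C.polarPath b n).ZH H < (2 : ℝ) ^ (-((2 : ℝ) ^ (β * (n : ℝ)))) := by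
  have hq : (1 : ℝ) ≤ (Fintype.card G : ℝ) ^ 2 :=
    one_le_pow₀ (by exact_mod_cast Fintype.card_pos (α := G))
  refine eventually_lt_two_rpow_neg hq (fun n => ZH_nonneg _ H) (fun n h => ?_) (fun n h => ?_)
    hlim hb hβ
  · rw [C.polarPath_succ_false h]; exact ZH_minus_le _ H
  · rw [C.polarPath_succ_true h]
    exact (ZH_plus_le _ H).trans (le_mul_of_one_le_left (sq_nonneg _) hq)

lemma goodCount_not (p : ℕ → Bool) (n : ℕ) :
    (goodCount (fun k => !p k) n : ℝ) = n - goodCount p n := by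
  induction n with
  | zero => simp [goodCount]
  | succ n ih =>
    rw [goodCount_succ, goodCount_succ]
    push_cast
    rw [ih]
    cases p n <;> simp; ring

lemma tendsto_goodCount_not
    (hb : Tendsto (fun n : ℕ => (goodCount b n : ℝ) / n) atTop (𝓝 (1 / 2))) :
    Tendsto (fun n : ℕ => (goodCount (fun k => !b k) n : ℝ) / n) atTop (𝓝 (1 / 2)) := by
  have h := hb.const_sub 1
  norm_num at h
  refine (h.congr' ?_).trans (by norm_num)
  filter_upwards [eventually_ne_atTop 0] with n hn
  have : (n : ℝ) ≠ 0 := by exact_mod_cast hn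
  rw [goodCount_not]
  field_simp

/-- Fast polarization of `1 - Z_d` with the two transforms exchanged: minus steps square it up to
the factor 4, plus steps at most double it. -/
lemma eventually_threshold_le_Zd {d : G} (hd2 : d + d = 0)
    (hb : Tendsto (fun n : ℕ => (goodCount b n : ℝ) / n) atTop (𝓝 (1 / 2)))
    (hd : d ∈ C.limitSubgroup b) (β : ℝ) :
    ∀ᶠ n : ℕ in atTop, (2 : ℝ) ^ (-((2 : ℝ) ^ (β * (n : ℝ)))) ≤ (C.polarPath b n).Zd d := by
  have hlim : Tendsto (fun n => 1 - (C.polarPath b n).Zd d) atTop (𝓝 0) := by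
    simpa using ((C.mem_limitSubgroup b).mp hd).const_sub 1
  have h := eventually_lt_two_rpow_neg (A := 4) (p := fun k => !b k)
    (x := fun n => 1 - (C.polarPath b n).Zd d) (by norm_num)
    (fun n => sub_nonneg.mpr (Zd_le_one _ _))
    (fun n h => by
      simp only [Bool.not_eq_false'] at h
      simp only [C.polarPath_succ_true h]
      refine (one_sub_Zd_plus_le _ d).trans ?_
      have := Zd_le_one (C.polarPath b n) d
      linarith)
    (fun n h => by
      simp only [Bool.not_eq_true'] at h
      simp only [C.polarPath_succ_false h]
      exact one_sub_Zd_minus_le _ hd2)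
    hlim (tendsto_goodCount_not hb) (show (1 / 4 : ℝ) < 1 / 2 by norm_num)
  filter_upwards [h, eventually_two_rpow_neg_le_one_sub β] with n h1 h2
  linarith

lemma eventually_not_ZH_lt {H : AddSubgroup G} {d : G}
    (hb : Tendsto (fun n : ℕ => (goodCount b n : ℝ) / n) atTop (𝓝 (1 / 2)))
    (hd : d ∈ C.limitSubgroup b) (hdH : d ∉ H) (β : ℝ) :
    ∀ᶠ n : ℕ in atTop, ¬ (C.polarPath b n).ZH H < (2 : ℝ) ^ (-((2 : ℝ) ^ (β * (n : ℝ)))) := by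
  classical
  by_cases hd2 : d + d = 0
  · filter_upwards [eventually_threshold_le_Zd hd2 hb hd β] with n hn
    exact not_lt.mpr (hn.trans (Zd_le_ZH _ hdH))
  -- Here `Z_d = Z_{-d} > 1/2` are two distinct terms of `Z^H`, so `Z^H > 1`, while the threshold
  -- never exceeds 1.
  · have hne : d ≠ -d := fun h => hd2 (by nth_rewrite 2 [h]; simp)
    filter_upwards [((C.mem_limitSubgroup b).mp hd).eventually
      (lt_mem_nhds (show (1 / 2 : ℝ) < 1 by norm_num))] with n hn
    have hle : (C.polarPath b n).Zd d + (C.polarPath b n).Zd (-d) ≤ (C.polarPath b n).ZH H := by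
      rw [← Finset.sum_pair hne]
      refine Finset.sum_le_sum_of_subset_of_nonneg (fun e he => ?_) fun _ _ _ => Zd_nonneg _ _
      simp only [Finset.mem_insert, Finset.mem_singleton] at he
      rcases he with rfl | rfl <;> simp [hdH]
    rw [Zd_neg] at hle
    have : (2 : ℝ) ^ (-((2 : ℝ) ^ (β * (n : ℝ)))) ≤ 1 :=
      Real.rpow_le_one_of_one_le_of_nonpos (by norm_num) (by simp; positivity)
    linarith

end DMChannel

/-! ### Fair independent bits -/

lemma polarIndex_congr {b b' : ℕ → Bool} {n : ℕ} (h : ∀ k < n, b k = b' k) :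
    polarIndex b n = polarIndex b' n := by
  induction n with
  | zero => rfl
  | succ n ih =>
    simp only [polarIndex, ih fun k hk => h k (by omega), h n (by omega)]

section FairBits

variable {Ω : Type*} [MeasurableSpace Ω] {μ : Measure Ω} [IsProbabilityMeasure μ]
  {B : ℕ → Ω → Bool}

lemma measurable_polarIndex (hB_meas : ∀ n, Measurable (B n)) (n : ℕ) :
    Measurable fun ω => polarIndex (fun k => B k ω) n := by
  induction n with
  | zero => exact measurable_const
  | succ n ih =>
    have h : Measurable fun x : ℕ × Bool => 2 * x.1 + x.2.toNat := Measurable.of_discrete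
    exact h.comp (ih.prodMk (hB_meas n))

lemma indepFun_polarIndex (hB_meas : ∀ n, Measurable (B n)) (hB_indep : iIndepFun B μ) (n : ℕ) :
    IndepFun (fun ω => polarIndex (fun k => B k ω) n) (B n) μ := by
  have h := hB_indep.indepFun_finset (Finset.range n) {n} (by simp) hB_meas
  -- The default `false` is never read: the index at time `n` uses only the bits below `n`.
  let g : (Finset.range n → Bool) → ℕ := fun t =>
    polarIndex (fun k => if hk : k ∈ Finset.range n then t ⟨k, hk⟩ else false) n
  let g' : (({n} : Finset ℕ) → Bool) → Bool := fun t => t ⟨n, Finset.mem_singleton_self n⟩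
  have hc := h.comp (φ := g) (ψ := g') (measurable_of_finite _) (measurable_of_finite _)
  have hg : (fun ω => polarIndex (fun k => B k ω) n)
      = g ∘ fun ω (i : Finset.range n) => B i ω := by
    funext ω
    refine polarIndex_congr fun k hk => ?_
    simp [hk]
  rw [hg]
  exact hc

lemma integral_comp_fair (hB_meas : ∀ n, Measurable (B n))
    (hB_fair : ∀ n, μ.real {ω | B n ω = true} = 1 / 2) (n : ℕ) (f : Bool → ℝ) :
    ∫ ω, f (B n ω) ∂μ = (f true + f false) / 2 := by
  have hmeas : MeasurableSet {ω | B n ω = true} := hB_meas n (measurableSet_singleton true)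
  have h : ∀ ω, f (B n ω) = f false
      + {ω | B n ω = true}.indicator (fun _ => f true - f false) ω := by
    intro ω
    cases hω : B n ω <;> simp [Set.indicator, hω]
  simp_rw [h]
  rw [integral_add (integrable_const _) ((integrable_const _).indicator hmeas),
    integral_indicator_const _ hmeas, hB_fair]
  simp
  ring

lemma ae_tendsto_goodCount (hB_meas : ∀ n, Measurable (B n)) (hB_indep : iIndepFun B μ)
    (hB_fair : ∀ n, μ.real {ω | B n ω = true} = 1 / 2) :
    ∀ᵐ ω ∂μ, Tendsto (fun n : ℕ => (goodCount (fun k => B k ω) n : ℝ) / n) atTop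
      (𝓝 (1 / 2)) := by
  let f : Bool → ℝ := fun b => (b.toNat : ℝ)
  have hf : Measurable f := measurable_of_finite _
  have hident : ∀ i, IdentDistrib (B i) (B 0) μ μ := by
    intro i
    refine ⟨(hB_meas i).aemeasurable, (hB_meas 0).aemeasurable, ?_⟩
    have : ∀ n, IsProbabilityMeasure (μ.map (B n)) := fun n =>
      Measure.isProbabilityMeasure_map (hB_meas n).aemeasurable
    have ht : ∀ n, (μ.map (B n)).real {true} = 1 / 2 := fun n => by
      rw [map_measureReal_apply (hB_meas n) (measurableSet_singleton _)]
      exact hB_fair n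
    have hfalse : ∀ n, (μ.map (B n)).real {false} = 1 / 2 := fun n => by
      have := probReal_compl_eq_one_sub (μ := μ.map (B n)) (measurableSet_singleton true)
      rw [ht, Bool.compl_singleton] at this
      simpa using this.trans (by norm_num)
    refine Measure.ext_of_singleton fun b => ?_
    rw [← measureReal_eq_measureReal_iff]
    cases b
    · rw [hfalse, hfalse]
    · rw [ht, ht]
  have hbdd : Integrable (fun ω => f (B 0 ω)) μ := by
    refine Integrable.of_bound (hf.comp (hB_meas 0)).aestronglyMeasurable 1
      (Eventually.of_forall fun ω => ?_)
    cases B 0 ω <;> simp [f]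
  have h := strong_law_ae_real (μ := μ) (fun n ω => f (B n ω)) hbdd
    (fun i j hij => (hB_indep.indepFun hij).comp hf hf) (fun i => (hident i).comp hf)
  rw [integral_comp_fair hB_meas hB_fair 0 f] at h
  filter_upwards [h] with ω hω
  simp only [f, Bool.toNat_true, Bool.toNat_false, Nat.cast_one, Nat.cast_zero, add_zero] at hω
  simpa [goodCount] using hω

end FairBits

/-! ### The equivocation martingale -/

namespace DMChannel

variable {G : Type u} [AddCommGroup G] [Fintype G] (C : DMChannel G)
  {Ω : Type*} [MeasurableSpace Ω] {μ : Measure Ω} [IsProbabilityMeasure μ] {B : ℕ → Ω → Bool}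

/-- The increase of the equivocation under the minus transform. -/
noncomputable def equivocationGap (C : DMChannel G) : ℝ := C.minus.equivocation - C.equivocation

/-- `F` needs no measurability: it is composed with an index in the discrete space `ℕ`. -/
lemma measurable_polarPath (hB_meas : ∀ n, Measurable (B n)) (F : DMChannel G → ℝ) (n : ℕ) :
    Measurable fun ω => F (C.polarPath (fun k => B k ω) n) :=
  (measurable_from_top (f := fun i => F (C.synth n i))).comp (measurable_polarIndex hB_meas n)

lemma abs_equivocationGap_le : |C.equivocationGap| ≤ (Fintype.card G : ℝ) ^ 2 := by
  have h1 := C.equivocation_nonneg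
  have h2 := C.equivocation_le
  have h3 := C.minus.equivocation_nonneg
  have h4 := C.minus.equivocation_le
  rw [equivocationGap, abs_le]
  constructor <;> linarith

/-- Orthogonality of martingale increments: the increment is the gap times a fair sign independent
of the past, so the cross term integrates to zero. -/
lemma integral_equivocation_sq_succ (hB_meas : ∀ n, Measurable (B n)) (hB_indep : iIndepFun B μ)
    (hB_fair : ∀ n, μ.real {ω | B n ω = true} = 1 / 2) (n : ℕ) :
    ∫ ω, (C.polarPath (fun k => B k ω) (n + 1)).equivocation ^ 2 ∂μ
      = ∫ ω, (C.polarPath (fun k => B k ω) n).equivocation ^ 2 ∂μ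
        + ∫ ω, (C.polarPath (fun k => B k ω) n).equivocationGap ^ 2 ∂μ := by
  let s : Bool → ℝ := fun b => if b then -1 else 1
  let h : ℕ → Ω → ℝ := fun n ω => (C.polarPath (fun k => B k ω) n).equivocation
  let D : ℕ → Ω → ℝ := fun n ω => (C.polarPath (fun k => B k ω) n).equivocationGap
  let q : ℝ := (Fintype.card G : ℝ) ^ 2
  have hm : ∀ n, Measurable (h n) := fun n => C.measurable_polarPath hB_meas equivocation n
  have hDm : ∀ n, Measurable (D n) := fun n => C.measurable_polarPath hB_meas equivocationGap n
  have hb : ∀ n ω, |h n ω| ≤ q := fun n ω => by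
    rw [abs_of_nonneg (equivocation_nonneg _)]; exact equivocation_le _
  have hDb : ∀ n ω, |D n ω| ≤ q := fun n ω => abs_equivocationGap_le _
  have hstep : ∀ ω, h (n + 1) ω ^ 2
      = h n ω ^ 2 + D n ω ^ 2 + 2 * h n ω * D n ω * s (B n ω) := by
    intro ω
    cases hω : B n ω with
    | true =>
      have e := equivocation_minus_add_plus (C.polarPath (fun k => B k ω) n)
      simp only [h, D, s, C.polarPath_succ_true (b := fun k => B k ω) hω, equivocationGap, if_true]
      rw [show (C.polarPath (fun k => B k ω) n).plus.equivocation
        = 2 * (C.polarPath (fun k => B k ω) n).equivocation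
          - (C.polarPath (fun k => B k ω) n).minus.equivocation by linarith]
      ring
    | false =>
      simp only [h, D, s, C.polarPath_succ_false (b := fun k => B k ω) hω, equivocationGap,
        Bool.false_eq_true, if_false]
      ring
  have hint1 : Integrable (fun ω => h n ω ^ 2) μ :=
    Integrable.of_bound ((hm n).pow_const 2).aestronglyMeasurable (q ^ 2)
      (Eventually.of_forall fun ω => by
        rw [Real.norm_eq_abs, abs_pow]
        exact pow_le_pow_left₀ (abs_nonneg _) (hb n ω) 2)
  have hint2 : Integrable (fun ω => D n ω ^ 2) μ :=
    Integrable.of_bound ((hDm n).pow_const 2).aestronglyMeasurable (q ^ 2)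
      (Eventually.of_forall fun ω => by
        rw [Real.norm_eq_abs, abs_pow]
        exact pow_le_pow_left₀ (abs_nonneg _) (hDb n ω) 2)
  have hsm : Measurable s := measurable_of_finite _
  have hint3 : Integrable (fun ω => 2 * h n ω * D n ω * s (B n ω)) μ :=
    Integrable.of_bound ((((hm n).const_mul 2).mul (hDm n)).mul
      (hsm.comp (hB_meas n))).aestronglyMeasurable (2 * q * q)
      (Eventually.of_forall fun ω => by
        have hs : |s (B n ω)| = 1 := by cases B n ω <;> simp [s]
        rw [Real.norm_eq_abs, abs_mul, abs_mul, abs_mul, hs, mul_one, abs_two]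
        exact mul_le_mul (mul_le_mul_of_nonneg_left (hb n ω) two_pos.le) (hDb n ω) (abs_nonneg _)
          (by positivity))
  have hzero : ∫ ω, 2 * h n ω * D n ω * s (B n ω) ∂μ = 0 := by
    have hind : IndepFun (fun ω => 2 * h n ω * D n ω) (fun ω => s (B n ω)) μ :=
      (indepFun_polarIndex hB_meas hB_indep n).comp
        (φ := fun i => 2 * (C.synth n i).equivocation * (C.synth n i).equivocationGap)
        measurable_from_top hsm
    rw [hind.integral_fun_mul_eq_mul_integral
      ((((hm n).const_mul 2).mul (hDm n))).aestronglyMeasurable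
      (hsm.comp (hB_meas n)).aestronglyMeasurable, integral_comp_fair hB_meas hB_fair n s]
    simp [s]
  change ∫ ω, h (n + 1) ω ^ 2 ∂μ = ∫ ω, h n ω ^ 2 ∂μ + ∫ ω, D n ω ^ 2 ∂μ
  rw [integral_congr_ae (Eventually.of_forall hstep),
    integral_add (f := fun ω => h n ω ^ 2 + D n ω ^ 2) (hint1.add hint2) hint3, hzero, add_zero,
    integral_add hint1 hint2]

/-- The expected squared gaps telescope to a bounded quantity, so `∑ D n ^ 2` is integrable and
almost surely finite. -/
lemma ae_tendsto_equivocationGap (hB_meas : ∀ n, Measurable (B n)) (hB_indep : iIndepFun B μ)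
    (hB_fair : ∀ n, μ.real {ω | B n ω = true} = 1 / 2) :
    ∀ᵐ ω ∂μ, Tendsto (fun n => (C.polarPath (fun k => B k ω) n).equivocationGap) atTop
      (𝓝 0) := by
  let h : ℕ → Ω → ℝ := fun n ω => (C.polarPath (fun k => B k ω) n).equivocation
  let D : ℕ → Ω → ℝ := fun n ω => (C.polarPath (fun k => B k ω) n).equivocationGap
  let q : ℝ := (Fintype.card G : ℝ) ^ 2
  have hDm : ∀ n, Measurable (D n) := fun n => C.measurable_polarPath hB_meas equivocationGap n
  have hint : ∀ n, Integrable (fun ω => D n ω ^ 2) μ := fun n =>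
    Integrable.of_bound ((hDm n).pow_const 2).aestronglyMeasurable (q ^ 2)
      (Eventually.of_forall fun ω => by
        rw [Real.norm_eq_abs, abs_pow]
        exact pow_le_pow_left₀ (abs_nonneg _) (abs_equivocationGap_le _) 2)
  have htel : ∀ n, ∑ k ∈ Finset.range n, ∫ ω, D k ω ^ 2 ∂μ
      = ∫ ω, h n ω ^ 2 ∂μ - ∫ ω, h 0 ω ^ 2 ∂μ := by
    intro n
    rw [← Finset.sum_range_sub (fun n => ∫ ω, h n ω ^ 2 ∂μ)]
    refine Finset.sum_congr rfl fun k _ => ?_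
    have := C.integral_equivocation_sq_succ hB_meas hB_indep hB_fair k
    simp only [h, D]
    linarith
  have hbound : ∀ n, ∑ k ∈ Finset.range n, ∫ ω, D k ω ^ 2 ∂μ ≤ q ^ 2 := by
    intro n
    have h0 : 0 ≤ ∫ ω, h 0 ω ^ 2 ∂μ := integral_nonneg fun ω => sq_nonneg _
    have h1 : ∫ ω, h n ω ^ 2 ∂μ ≤ q ^ 2 := by
      have := integral_mono_of_nonneg (μ := μ) (f := fun ω => h n ω ^ 2) (g := fun _ => q ^ 2)
        (Eventually.of_forall fun ω => sq_nonneg _) (integrable_const _)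
        (Eventually.of_forall fun ω =>
          pow_le_pow_left₀ (equivocation_nonneg _) (equivocation_le _) 2)
      simpa using this
    rw [htel]; linarith
  have hsummable : Summable fun n => ∫ ω, D n ω ^ 2 ∂μ :=
    summable_of_sum_range_le (fun n => integral_nonneg fun ω => sq_nonneg _) hbound
  have hl : ∫⁻ ω, ∑' n, ENNReal.ofReal (D n ω ^ 2) ∂μ ≠ ⊤ := by
    rw [lintegral_tsum fun n => ((hDm n).pow_const 2).ennreal_ofReal.aemeasurable]
    simp_rw [← ofReal_integral_eq_lintegral_ofReal (hint _)
      (Eventually.of_forall fun ω => sq_nonneg _)]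
    exact hsummable.tsum_ofReal_ne_top
  have hae := ae_lt_top (Measurable.tsum fun n =>
    ((hDm n).pow_const 2).ennreal_ofReal) hl
  filter_upwards [hae] with ω hω
  have h1 := ENNReal.tendsto_atTop_zero_of_tsum_ne_top hω.ne
  have h2 := (ENNReal.tendsto_toReal ENNReal.zero_ne_top).comp h1
  simp only [Function.comp_def, ENNReal.toReal_ofReal (sq_nonneg _), ENNReal.toReal_zero] at h2
  have h3 := h2.sqrt
  simp only [Real.sqrt_sq_eq_abs, Real.sqrt_zero] at h3
  exact tendsto_zero_iff_abs_tendsto_zero _ |>.mpr h3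

end DMChannel

/-! ### Assembly of the theorem -/

open DMChannel

open Classical in
theorem mainTheorem5 {G : Type u} [AddCommGroup G] [Fintype G] (C : DMChannel G)
    {Ω : Type*} [MeasurableSpace Ω] (μ : Measure Ω) [IsProbabilityMeasure μ]
    (B : ℕ → Ω → Bool) (hB_meas : ∀ n, Measurable (B n)) (hB_indep : iIndepFun B μ)
    (hB_fair : ∀ n, μ.real {ω | B n ω = true} = 1 / 2)
    (H : AddSubgroup G) :
    ∃ Zinf : Ω → ℝ, Measurable Zinf ∧
      (∀ᵐ ω ∂μ, Tendsto (fun n => (C.synth n (polarIndex (fun k => B k ω) n)).ZH H) atTop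
        (𝓝 (Zinf ω))) ∧
      (∀ β : ℝ, β < 1 / 2 → ∃ L : ℝ,
        Tendsto (fun n : ℕ => μ.real {ω | (C.synth n (polarIndex (fun k => B k ω) n)).ZH H
          < (2 : ℝ) ^ (-((2 : ℝ) ^ (β * (n : ℝ))))}) atTop (𝓝 L) ∧
        μ.real {ω | Zinf ω = 0} ≤ L) ∧
      μ.real {ω | Zinf ω = 0} = ∑ S : AddSubgroup G with S ≤ H, polarCaseProb C μ B S := by
  have hZm : ∀ (d : G) (n : ℕ), Measurable fun ω => (C.polarPath (fun k => B k ω) n).Zd d :=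
    fun d n => C.measurable_polarPath hB_meas (fun V => V.Zd d) n
  have hlimm : ∀ (d : G) (z : ℝ), MeasurableSet
      {ω | Tendsto (fun n => (C.polarPath (fun k => B k ω) n).Zd d) atTop (𝓝 z)} :=
    fun d z => measurableSet_tendsto _ (hZm d)
  let S : Ω → AddSubgroup G := fun ω => C.limitSubgroup fun k => B k ω
  have hSm : ∀ d : G, MeasurableSet {ω | d ∈ S ω} := fun d => hlimm d 1
  have hpol : ∀ᵐ ω ∂μ, ∀ d : G, Tendsto (fun n => (C.polarPath (fun k => B k ω) n).Zd d) atTop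
      (𝓝 (if d ∈ S ω then 1 else 0)) := by
    filter_upwards [C.ae_tendsto_equivocationGap hB_meas hB_indep hB_fair] with ω hω d
    split_ifs with hd
    · exact hd
    · exact (C.Zd_polarPath_dichotomy _ hω d).resolve_right hd
  -- Counting the elements of the limit subgroup outside `H` gives a variable defined and measurable
  -- on all of `Ω`, also where nothing converges.
  let Zinf : Ω → ℝ := fun ω => ∑ d : G with d ∉ H, if d ∈ S ω then (1 : ℝ) else 0
  have hZinfm : Measurable Zinf :=
    Finset.measurable_sum _ fun d _ => Measurable.ite (hSm d) measurable_const measurable_const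
  have hconv : ∀ᵐ ω ∂μ, Tendsto (fun n => (C.polarPath (fun k => B k ω) n).ZH H) atTop
      (𝓝 (Zinf ω)) := by
    filter_upwards [hpol] with ω hω
    exact tendsto_finsetSum _ fun d _ => hω d
  have hzero : ∀ ω, Zinf ω = 0 ↔ S ω ≤ H := by
    intro ω
    simp only [Zinf]
    rw [Finset.sum_eq_zero_iff_of_nonneg fun d _ => by split_ifs <;> norm_num]
    constructor
    · intro h d hd
      by_contra hdH
      simpa [hd] using h d (by simp [hdH])
    · intro h d hd
      rw [if_neg fun hdS => (Finset.mem_filter.mp hd).2 (h hdS)]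
  have hzm : MeasurableSet {ω | Zinf ω = 0} := hZinfm (measurableSet_singleton 0)
  -- The limit is `P(Zinf = 0)` itself, so the stated inequality is an equality.
  refine ⟨Zinf, hZinfm, hconv, fun β hβ => ⟨μ.real {ω | Zinf ω = 0}, ?_, le_rfl⟩, ?_⟩
  · refine (ENNReal.tendsto_toReal (measure_ne_top _ _)).comp
      (tendsto_measure_of_ae_tendsto_indicator_of_isFiniteMeasure atTop hzm (fun n =>
        measurableSet_lt (C.measurable_polarPath hB_meas (fun V => V.ZH H) n)
          measurable_const) ?_)
    filter_upwards [hconv, ae_tendsto_goodCount hB_meas hB_indep hB_fair] with ω hω hb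
    by_cases h0 : Zinf ω = 0
    · rw [h0] at hω
      filter_upwards [eventually_ZH_lt hb hω hβ] with n hn
      exact iff_of_true hn h0
    · obtain ⟨d, hd, hdH⟩ := SetLike.not_le_iff_exists.mp (mt (hzero ω).mpr h0)
      filter_upwards [eventually_not_ZH_lt hb hd hdH β] with n hn
      exact iff_of_false hn h0
  · let F : AddSubgroup G → Set Ω := fun T => {ω | ∀ d : G, Tendsto
      (fun n => (C.polarPath (fun k => B k ω) n).Zd d) atTop (𝓝 (if d ∈ T then 1 else 0))}
    have hFm : ∀ T, MeasurableSet (F T) := fun T => by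
      simp only [F, Set.ofPred_forall]
      exact MeasurableSet.iInter fun d => hlimm d _
    have hFS : ∀ T ω, ω ∈ F T → S ω = T := by
      intro T ω hω
      ext d
      by_cases hd : d ∈ T
      · refine iff_of_true ?_ hd
        simpa [hd] using! hω d
      · refine iff_of_false (fun hdS => ?_) hd
        have h0 := hω d
        rw [if_neg hd] at h0
        exact zero_ne_one (tendsto_nhds_unique h0 hdS)
    -- The events are disjoint because the limits determine the subgroup; by `hpol` they cover
    -- almost all of `Ω`.
    have hdisj : Set.PairwiseDisjoint (↑({T | T ≤ H} : Finset (AddSubgroup G))) F := by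
      intro T _ T' _ hne
      refine Set.disjoint_left.mpr fun ω h h' => hne ?_
      rw [← hFS T ω h, hFS T' ω h']
    change _ = ∑ T : AddSubgroup G with T ≤ H, μ.real (F T)
    rw [← measureReal_biUnion_finset hdisj fun T _ => hFm T]
    refine measureReal_congr ?_
    filter_upwards [hpol] with ω hω
    refine propext ?_
    change Zinf ω = 0 ↔ ω ∈ ⋃ T ∈ ({T | T ≤ H} : Finset (AddSubgroup G)), F T
    rw [hzero]
    simp only [Set.mem_iUnion, Finset.mem_filter, Finset.mem_univ, true_and, exists_prop]
    exact ⟨fun h => ⟨S ω, h, hω⟩, fun ⟨T, hT, hωT⟩ => (hFS T ω hωT).trans_le hT⟩
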